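/- Let $G$ be a finite simple undirected bipartite graph with vertex set $S\sqcup R$ ($S$ the source side, $R$ the range side) such that every path-connected component of $G$ is a complete bipartite graph. Let $P$ be the finite set of components, and for $p\in P$ let $S_p$ and $R_p$ be the sets of source and range vertices in $p$. For each $p\in P$ let $H_p$ be a finite-dimensional complex Hilbert space. Put $$\mathcal H_S=\bigoplus_{p\in P}\ell^2\otimes\mathbb C^{S_p}\otimes H_p,\qquad \mathcal H_R=\bigoplus_{p\in P}\ell^2\otimes\mathbb C^{R_p}\otimes H_p,$$ where $\ell^2=\ell^2(\mathbb Z_+)$, and let $V_S=V\otimes I$ on $\mathcal H_S$ and $V_R=V\otimes I$ on $\mathcal H_R$, where $V:(x_0,x_1,\dots)\mapsto(0,x_0,x_1,\dots)$ is the unilateral shift on $\ell^2$. For a vertex $v$ of the component $p$ let $\iota_v$ be the canonical embedding of $\ell^2\otimes H_p$ as the $v$-th summand of $\mathcal H_S$ (if $v\in S$) or of $\mathcal H_R$ (if $v\in R$). Let $\Delta_G\subset\mathcal L(\mathcal H_R,\mathcal H_S)$ be the set of all operators $$\sum_{e}\iota_{s(e)}\,(Z_e\otimes I_{H_{[e]}})\,\iota_{r(e)}^*,\qquad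 Z_e\in\mathcal L(\ell^2),$$ the sum being over the edges $e$ of $G$, where $s(e)\in S$ and $r(e)\in R$ are the end points of $e$ and $[e]$ is its component. Let $$\Delta_G'=\{(X,Y)\in\mathcal L(\mathcal H_R)\times\mathcal L(\mathcal H_S):\ \Delta X=Y\Delta\ \text{ for all }\Delta\in\Delta_G\}.$$ For a bounded operator $M:\mathcal H_S\to\mathcal H_R$ define $$\mu(M)=\frac1{\inf\{\|\Delta\|:\ \Delta\in\Delta_G,\ 1\in\sigma(M\Delta)\}},\qquad \widehat\mu(M)=\inf\{\|XMY^{-1}\|:\ (X,Y)\in\Delta_G',\ X,Y\text{ invertible}\},$$ with $\mu(M)=0$ if there is no $\Delta\in\Delta_G$ with $1\in\sigma(M\Delta)$. Theorem. Let $M:\mathcal H_S\to\mathcal H_R$ be a bounded linear operator that is shift-invariant, i.e. $V_RM=MV_S$. Then $$\mu(M)=\widehat\mu(M).$$ Moreover, the following four conditions are equivalent: (1) $\mu(M)<1$; (1') there is $\rho>1$ such that $I-\Delta M$ has a bounded inverse for every $\Delta=\operatorname{diag}_{p\in P}(W_p\otimes I_{H_p})$ with $W_p\in\mathcal L(\ell^2\otimes\mathbb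 C^{R_p},\,\ell^2\otimes\mathbb C^{S_p})$ and $\|W_p\|\le\rho$ for all $p\in P$; (2) $\widehat\mu(M)<1$; (2') there are operators $\Gamma_p\succ0$ on $H_p$ ($p\in P$) such that $$M^*\Big(\bigoplus_{p\in P}I_{\ell^2\otimes\mathbb C^{R_p}}\otimes\Gamma_p\Big)M-\Big(\bigoplus_{p\in P}I_{\ell^2\otimes\mathbb C^{S_p}}\otimes\Gamma_p\Big)\prec0.$$ Here $T\succ0$ means that $T$ is positive and boundedly invertible (equivalently, $T\succeq\varepsilon I$ for some $\varepsilon>0$), and $T\prec0$ means $-T\succ0$. -/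

import Mathlib

open scoped ENNReal

/-- A simple undirected bipartite graph with source side `S` and range side `R`, each of whose
path-connected components is a complete bipartite graph: a source and a range vertex lying in the
same component are adjacent. -/
structure AdmissibleGraph (V : Type*) where
  G : SimpleGraph V
  S : Set V
  R : Set V
  bipartite : G.IsBipartiteWith S R
  cover : S ∪ R = Set.univ
  complete : ∀ s ∈ S, ∀ r ∈ R, G.Reachable s r → G.Adj s r

noncomputable section

namespace AdmissibleGraph

variable {V : Type*} (A : AdmissibleGraph V)

/-- The set `P` of path-connected components. -/
def Comp : Type _ := A.G.ConnectedComponent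

/-- The component `[v]` of a vertex `v`. -/
def comp (v : V) : A.Comp := A.G.connectedComponentMk v

/-- The source vertices `S_p` of the component `p`. -/
def SrcOf (p : A.Comp) : Type _ := {v : V // v ∈ A.S ∧ A.comp v = p}

/-- The range vertices `R_p` of the component `p`. -/
def RngOf (p : A.Comp) : Type _ := {v : V // v ∈ A.R ∧ A.comp v = p}

/-- The source vertices `s`, recorded as pairs `⟨[s], s⟩`. -/
def Src : Type _ := Σ p : A.Comp, A.SrcOf p

/-- The range vertices `r`, recorded as pairs `⟨[r], r⟩`. -/
def Rng : Type _ := Σ p : A.Comp, A.RngOf p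

/-- The edges `e`, recorded as `⟨p, s(e), r(e)⟩` with `p = [s(e)] = [r(e)]`. -/
def Edge : Type _ :=
  {e : Σ p : A.Comp, A.SrcOf p × A.RngOf p // A.G.Adj e.2.1.1 e.2.2.1}

variable {A}

/-- The component of an edge. -/
def Edge.comp (e : A.Edge) : A.Comp := e.1.1

/-- The source vertex `s(e)` of an edge. -/
def Edge.src (e : A.Edge) : A.SrcOf e.comp := e.1.2.1

/-- The range vertex `r(e)` of an edge. -/
def Edge.rng (e : A.Edge) : A.RngOf e.comp := e.1.2.2

variable (A)

section Finiteness

variable [Finite V]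

instance : Finite A.Comp := inferInstanceAs (Finite (Quot _))

instance (p : A.Comp) : Finite (A.SrcOf p) := inferInstanceAs (Finite (Subtype _))

instance (p : A.Comp) : Finite (A.RngOf p) := inferInstanceAs (Finite (Subtype _))

instance : Finite A.Src := inferInstanceAs (Finite (Sigma _))

instance : Finite A.Rng := inferInstanceAs (Finite (Sigma _))

instance : Finite A.Edge := inferInstanceAs (Finite (Subtype _))

instance : Fintype A.Comp := Fintype.ofFinite _

instance (p : A.Comp) : Fintype (A.SrcOf p) := Fintype.ofFinite _

instance (p : A.Comp) : Fintype (A.RngOf p) := Fintype.ofFinite _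

instance : Fintype A.Src := Fintype.ofFinite _

instance : Fintype A.Rng := Fintype.ofFinite _

instance : Fintype A.Edge := Fintype.ofFinite _

end Finiteness

end AdmissibleGraph

section DirectSum

variable {ι : Type*} (E : ι → Type*)
  [∀ i, NormedAddCommGroup (E i)] [∀ i, InnerProductSpace ℂ (E i)]

/-- The canonical embedding `ι_i` of the summand `E i` into the Hilbert space direct sum. -/
def sumEmb (i : ι) : E i →L[ℂ] PiLp 2 E :=
  letI := Classical.decEq ι
  (PiLp.continuousLinearEquiv 2 ℂ E).symm.toContinuousLinearMap ∘L ContinuousLinearMap.single ℂ E i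

/-- The adjoint `ι_i^*` of the canonical embedding: the projection onto the summand `E i`. -/
def sumProj (i : ι) : PiLp 2 E →L[ℂ] E i := PiLp.proj 2 E i

theorem sumProj_sumEmb_same (i : ι) (x : E i) : sumProj E i (sumEmb E i x) = x := by
  simp [sumProj, sumEmb]

theorem sumProj_sumEmb_of_ne {i j : ι} (h : i ≠ j) (x : E j) :
    sumProj E i (sumEmb E j x) = 0 := by
  simp [sumProj, sumEmb, h]

theorem sum_sumEmb_sumProj [Fintype ι] (x : PiLp 2 E) : ∑ i, sumEmb E i (sumProj E i x) = x := by
  classical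
  ext j
  have h : ∀ i, sumProj E j (sumEmb E i (sumProj E i x)) = if i = j then x j else 0 := by
    intro i
    split_ifs with hij
    · subst hij
      exact sumProj_sumEmb_same E i _
    · exact sumProj_sumEmb_of_ne E (Ne.symm hij) _
  have h2 : sumProj E j (∑ i, sumEmb E i (sumProj E i x)) = x j := by
    rw [map_sum, Finset.sum_congr rfl fun i _ => h i]
    simp
  exact h2

end DirectSum

/-! ### Uncertainty structures for a general A-graph

Here `H p` is a Hilbert space for every component `p`, and `D p` is a set (in the applications
a `C^*`-algebra) of bounded operators on `H p`. -/

namespace AdmissibleGraph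

variable {V : Type*} [Finite V] (A : AdmissibleGraph V) (H : A.Comp → Type*)
  [∀ p, NormedAddCommGroup (H p)] [∀ p, InnerProductSpace ℂ (H p)]

/-- `H_S`, the Hilbert space direct sum of the spaces `H_s = H_[s]` over the source vertices. -/
abbrev HS : Type _ := PiLp 2 (fun s : A.Src => H s.1)

/-- `H_R`, the Hilbert space direct sum of the spaces `H_r = H_[r]` over the range vertices. -/
abbrev HR : Type _ := PiLp 2 (fun r : A.Rng => H r.1)

/-- `ι_s : H_p → H_S` for a source vertex `s` of the component `p`. -/
def embS {p : A.Comp} (s : A.SrcOf p) : H p →L[ℂ] A.HS H :=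
  sumEmb (fun s : A.Src => H s.1) ⟨p, s⟩

/-- `ι_r : H_p → H_R` for a range vertex `r` of the component `p`. -/
def embR {p : A.Comp} (r : A.RngOf p) : H p →L[ℂ] A.HR H :=
  sumEmb (fun r : A.Rng => H r.1) ⟨p, r⟩

/-- `ι_s^* : H_S → H_p` for a source vertex `s` of the component `p`. -/
def projS {p : A.Comp} (s : A.SrcOf p) : A.HS H →L[ℂ] H p :=
  sumProj (fun s : A.Src => H s.1) ⟨p, s⟩

/-- `ι_r^* : H_R → H_p` for a range vertex `r` of the component `p`. -/
def projR {p : A.Comp} (r : A.RngOf p) : A.HR H →L[ℂ] H p :=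
  sumProj (fun r : A.Rng => H r.1) ⟨p, r⟩

variable {H}

/-- `L(Z) = ∑_e ι_{s(e)} Z_e ι_{r(e)}^*`. -/
def pencil (Z : ∀ e : A.Edge, H e.comp →L[ℂ] H e.comp) : A.HR H →L[ℂ] A.HS H :=
  ∑ e : A.Edge, A.embS H e.src ∘L Z e ∘L A.projR H e.rng

/-- The uncertainty set `Δ`: all `L(Z)` with `Z_e` in `D_[s(e)] = D_[r(e)]` for every edge `e`. -/
def uncertainty (D : ∀ p, Set (H p →L[ℂ] H p)) : Set (A.HR H →L[ℂ] A.HS H) :=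
  {T | ∃ Z : ∀ e : A.Edge, H e.comp →L[ℂ] H e.comp, (∀ e, Z e ∈ D e.comp) ∧ T = A.pencil Z}

/-- The intertwining space `Δ'`: all `(X, Y)` with `T X = Y T` for every `T` in `Δ`. -/
def intertwining (D : ∀ p, Set (H p →L[ℂ] H p)) :
    Set ((A.HR H →L[ℂ] A.HR H) × (A.HS H →L[ℂ] A.HS H)) :=
  {XY | ∀ T ∈ A.uncertainty D, T ∘L XY.1 = XY.2 ∘L T}

/-- The structured singular value `1 / inf {‖T‖ : T ∈ Δ, 1 ∈ σ(M T)}`, as an element of `[0, ∞]`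
(so it is `0` if there is no such `T`). -/
def mu (D : ∀ p, Set (H p →L[ℂ] H p)) (M : A.HS H →L[ℂ] A.HR H) : ℝ≥0∞ :=
  (⨅ T ∈ {T ∈ A.uncertainty D | (1 : ℂ) ∈ spectrum ℂ (M ∘L T)}, ‖T‖ₑ)⁻¹

/-- The scaled upper bound `inf {‖X M Y⁻¹‖ : (X, Y) ∈ Δ', X and Y invertible}`. -/
def muHat (D : ∀ p, Set (H p →L[ℂ] H p)) (M : A.HS H →L[ℂ] A.HR H) : ℝ≥0∞ :=
  ⨅ (X : (A.HR H →L[ℂ] A.HR H)ˣ) (Y : (A.HS H →L[ℂ] A.HS H)ˣ)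
    (_ : ((X : A.HR H →L[ℂ] A.HR H), (Y : A.HS H →L[ℂ] A.HS H)) ∈ A.intertwining D),
    ‖(X : A.HR H →L[ℂ] A.HR H) ∘L M ∘L ((Y⁻¹ : (A.HS H →L[ℂ] A.HS H)ˣ) : A.HS H →L[ℂ] A.HS H)‖ₑ

end AdmissibleGraph

/-! ### The tensor product `ℓ² ⊗ H`, realized as the space of square-summable `H`-valued sequences

The pure tensor `x ⊗ h` is the sequence `n ↦ x n • h`. -/

/-- `ℓ² ⊗ H = ℓ²(ℤ₊; H)`. -/
abbrev Ell2 (H : Type*) [NormedAddCommGroup H] : Type _ := lp (fun _ : ℕ => H) 2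

instance finiteDimensional_completeSpace (H : Type*) [NormedAddCommGroup H]
    [InnerProductSpace ℂ H] [FiniteDimensional ℂ H] : CompleteSpace H :=
  FiniteDimensional.complete ℂ H

/-- The sequence `(0, f₀, f₁, …)`. -/
def shiftFun {H : Type*} [NormedAddCommGroup H] (f : ℕ → H) : ℕ → H
  | 0 => 0
  | n + 1 => f n

theorem hasSum_shiftFun {H : Type*} [NormedAddCommGroup H] (f : Ell2 H) :
    HasSum (fun n => ‖shiftFun (⇑f) n‖ ^ (2 : ℝ≥0∞).toReal) (‖f‖ ^ (2 : ℝ≥0∞).toReal) := by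
  have h := lp.hasSum_norm (p := 2) (by norm_num) f
  rw [← hasSum_nat_add_iff' 1]
  simpa [shiftFun] using h

section Ell2

variable {H K : Type*} [NormedAddCommGroup H] [InnerProductSpace ℂ H]
  [NormedAddCommGroup K] [InnerProductSpace ℂ K]

/-- `I ⊗ B : ℓ² ⊗ H → ℓ² ⊗ K`, which applies `B` to every entry of a sequence. -/
def idTensor (B : H →L[ℂ] K) : Ell2 H →L[ℂ] Ell2 K :=
  lp.mapCLM 2 (fun _ : ℕ => B) (norm_nonneg B) (fun _ => le_rfl)

@[simp]
theorem idTensor_apply (B : H →L[ℂ] K) (f : Ell2 H) (n : ℕ) : idTensor B f n = B (f n) := rfl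

/-- The operator `x ↦ x ⊗ h` from `ℓ²` to `ℓ² ⊗ H`. -/
def tensorVec (h : H) : Ell2 ℂ →L[ℂ] Ell2 H :=
  idTensor (ContinuousLinearMap.toSpanSingleton ℂ h)

@[simp]
theorem tensorVec_apply (h : H) (x : Ell2 ℂ) (n : ℕ) : tensorVec h x n = x n • h := rfl

/-- `V ⊗ I`, where `V` is the unilateral shift: `(x₀, x₁, …) ↦ (0, x₀, x₁, …)`. -/
def shift : Ell2 H →L[ℂ] Ell2 H :=
  LinearMap.mkContinuous
    { toFun := fun f => ⟨shiftFun (⇑f), memℓp_gen (hasSum_shiftFun f).summable⟩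
      map_add' := fun f g => by
        ext n
        cases n
        · exact (add_zero (0 : H)).symm
        · rfl
      map_smul' := fun c f => by
        ext n
        cases n
        · exact (smul_zero c).symm
        · rfl }
    1 fun f => by
      rw [one_mul]
      refine lp.norm_le_of_tsum_le (by norm_num) (norm_nonneg f) ?_
      exact (hasSum_shiftFun f).tsum_eq.le

@[simp]
theorem shift_zero (f : Ell2 H) : shift f 0 = 0 := rfl

@[simp]
theorem shift_succ (f : Ell2 H) (n : ℕ) : shift f (n + 1) = f n := rfl

theorem idTensor_inner_tensorVec (b h : H) (x : Ell2 ℂ) :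
    idTensor (innerSL ℂ b) (tensorVec h x) = inner ℂ b h • x := by
  ext n
  simp [mul_comm]

variable [FiniteDimensional ℂ H]

/-- `Z ⊗ I` on `ℓ² ⊗ H`, for an operator `Z` on `ℓ²` and a finite-dimensional space `H`. It is
written with an orthonormal basis `b` of `H` as the sum of the operators
`x ⊗ h ↦ (Z x) ⊗ ⟨h, b_i⟩ b_i`; `tensorId_tensorVec` shows that it is the usual ampliation. -/
def tensorId (Z : Ell2 ℂ →L[ℂ] Ell2 ℂ) : Ell2 H →L[ℂ] Ell2 H :=
  ∑ i, tensorVec (stdOrthonormalBasis ℂ H i) ∘L Z ∘L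
    idTensor (innerSL ℂ (stdOrthonormalBasis ℂ H i))

theorem sum_inner_smul_tensorVec (h : H) (x : Ell2 ℂ) :
    ∑ i, inner ℂ (stdOrthonormalBasis ℂ H i) h • tensorVec (stdOrthonormalBasis ℂ H i) x =
      tensorVec h x := by
  have hh := (stdOrthonormalBasis ℂ H).sum_repr' h
  ext n
  simp only [lp.coeFn_sum, lp.coeFn_smul, Finset.sum_apply, Pi.smul_apply, tensorVec_apply]
  conv_rhs => rw [← hh, Finset.smul_sum]
  exact Finset.sum_congr rfl fun i _ => smul_comm _ _ _

/-- `(Z ⊗ I) (x ⊗ h) = (Z x) ⊗ h`. -/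
theorem tensorId_tensorVec (Z : Ell2 ℂ →L[ℂ] Ell2 ℂ) (h : H) (x : Ell2 ℂ) :
    tensorId Z (tensorVec h x) = tensorVec h (Z x) := by
  rw [← sum_inner_smul_tensorVec h (Z x)]
  simp only [tensorId, sum_apply, ContinuousLinearMap.comp_apply, idTensor_inner_tensorVec,
    map_smul]

end Ell2

/-! ### The enhanced classical structure with `K = ℓ²`

Here `H p` is the finite-dimensional coefficient space of the component `p`; the A-graph has the
spaces `ℓ² ⊗ H p` and the algebras `L(ℓ²) ⊗ I`. -/

namespace AdmissibleGraph

variable {V : Type*} [Finite V] (A : AdmissibleGraph V) (H : A.Comp → Type*)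
  [∀ p, NormedAddCommGroup (H p)] [∀ p, InnerProductSpace ℂ (H p)]

/-- `ℓ² ⊗ H°_S`, the direct sum of the spaces `ℓ² ⊗ H_[s]` over the source vertices. -/
abbrev EnhS : Type _ := A.HS (fun p => Ell2 (H p))

/-- `ℓ² ⊗ H°_R`, the direct sum of the spaces `ℓ² ⊗ H_[r]` over the range vertices. -/
abbrev EnhR : Type _ := A.HR (fun p => Ell2 (H p))

/-- `ℓ² ⊗ ℂ^{S_p}`, the direct sum of copies of `ℓ²` over the source vertices of `p`. -/
abbrev TildeS (p : A.Comp) : Type _ := PiLp 2 (fun _ : A.SrcOf p => Ell2 ℂ)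

/-- `ℓ² ⊗ ℂ^{R_p}`, the direct sum of copies of `ℓ²` over the range vertices of `p`. -/
abbrev TildeR (p : A.Comp) : Type _ := PiLp 2 (fun _ : A.RngOf p => Ell2 ℂ)

/-- The algebras `L(ℓ²) ⊗ I` of operators on `ℓ² ⊗ H p`. -/
def enhanced [∀ p, FiniteDimensional ℂ (H p)] (p : A.Comp) :
    Set (Ell2 (H p) →L[ℂ] Ell2 (H p)) :=
  Set.range fun Z : Ell2 ℂ →L[ℂ] Ell2 ℂ => tensorId Z

variable {H}

/-- The direct sum over the source vertices `s` of the operators `B [s]`. -/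
def diagS (B : ∀ p, Ell2 (H p) →L[ℂ] Ell2 (H p)) : A.EnhS H →L[ℂ] A.EnhS H :=
  ∑ s : A.Src, A.embS (fun p => Ell2 (H p)) s.2 ∘L B s.1 ∘L A.projS (fun p => Ell2 (H p)) s.2

/-- The direct sum over the range vertices `r` of the operators `B [r]`. -/
def diagR (B : ∀ p, Ell2 (H p) →L[ℂ] Ell2 (H p)) : A.EnhR H →L[ℂ] A.EnhR H :=
  ∑ r : A.Rng, A.embR (fun p => Ell2 (H p)) r.2 ∘L B r.1 ∘L A.projR (fun p => Ell2 (H p)) r.2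

/-- Shift-invariance, `V_R M = M V_S`, where `V_S` and `V_R` are the ampliations of the
unilateral shift. -/
def ShiftInvariant (M : A.EnhS H →L[ℂ] A.EnhR H) : Prop :=
  A.diagR (fun _ => shift) ∘L M = M ∘L A.diagS (fun _ => shift)

/-- The map `x ↦ x ⊗ h` from `ℓ² ⊗ ℂ^{S_p}` to the summand `ℓ² ⊗ ℂ^{S_p} ⊗ H p` of
`ℓ² ⊗ H°_S`. -/
def tensorVecS (p : A.Comp) (h : H p) : A.TildeS p →L[ℂ] A.EnhS H :=
  ∑ s : A.SrcOf p, A.embS (fun p => Ell2 (H p)) s ∘L tensorVec h ∘L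
    sumProj (fun _ : A.SrcOf p => Ell2 ℂ) s

/-- The map `x ↦ x ⊗ h` from `ℓ² ⊗ ℂ^{R_p}` to the summand `ℓ² ⊗ ℂ^{R_p} ⊗ H p` of
`ℓ² ⊗ H°_R`. -/
def tensorVecR (p : A.Comp) (h : H p) : A.TildeR p →L[ℂ] A.EnhR H :=
  ∑ r : A.RngOf p, A.embR (fun p => Ell2 (H p)) r ∘L tensorVec h ∘L
    sumProj (fun _ : A.RngOf p => Ell2 ℂ) r

/-- The adjoint of `tensorVecR p b`: the map `x ⊗ h ↦ ⟨h, b⟩ x` on the summand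
`ℓ² ⊗ ℂ^{R_p} ⊗ H p`, and zero on the other summands. -/
def contractR (p : A.Comp) (b : H p) : A.EnhR H →L[ℂ] A.TildeR p :=
  ∑ r : A.RngOf p, sumEmb (fun _ : A.RngOf p => Ell2 ℂ) r ∘L idTensor (innerSL ℂ b) ∘L
    A.projR (fun p => Ell2 (H p)) r

theorem contractR_tensorVecR (p : A.Comp) (b h : H p) (x : A.TildeR p) :
    A.contractR p b (A.tensorVecR p h x) = inner ℂ b h • x := by
  have key : ∀ r : A.RngOf p, A.projR (fun p => Ell2 (H p)) r (A.tensorVecR p h x) =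
      tensorVec h (sumProj (fun _ : A.RngOf p => Ell2 ℂ) r x) := by
    intro r
    simp only [tensorVecR, sum_apply, ContinuousLinearMap.comp_apply, map_sum]
    rw [Finset.sum_eq_single r]
    · exact sumProj_sumEmb_same (fun r : A.Rng => Ell2 (H r.1)) ⟨p, r⟩ _
    · intro r' _ hr
      refine sumProj_sumEmb_of_ne (fun r : A.Rng => Ell2 (H r.1)) (i := ⟨p, r⟩) (j := ⟨p, r'⟩) ?_ _
      intro hh
      exact hr (eq_of_heq (Sigma.mk.inj hh).2).symm
    · intro hr
      exact absurd (Finset.mem_univ r) hr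
  simp only [contractR, sum_apply, ContinuousLinearMap.comp_apply, key,
    idTensor_inner_tensorVec, map_smul]
  rw [← Finset.smul_sum, sum_sumEmb_sumProj]

theorem contractR_tensorVecR_of_ne {p q : A.Comp} (hpq : q ≠ p) (b : H q) (h : H p)
    (x : A.TildeR p) : A.contractR q b (A.tensorVecR p h x) = 0 := by
  simp only [contractR, tensorVecR, sum_apply, ContinuousLinearMap.comp_apply, map_sum]
  refine Finset.sum_eq_zero fun r' _ => Finset.sum_eq_zero fun r _ => ?_
  have : A.projR (fun p => Ell2 (H p)) r (A.embR (fun p => Ell2 (H p)) r'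
      (tensorVec h (sumProj (fun _ : A.RngOf p => Ell2 ℂ) r' x))) = 0 := by
    refine sumProj_sumEmb_of_ne (fun r : A.Rng => Ell2 (H r.1)) (i := ⟨q, r⟩) (j := ⟨p, r'⟩) ?_ _
    intro hh
    exact hpq (Sigma.mk.inj hh).1
  rw [this, map_zero, map_zero]

variable [∀ p, FiniteDimensional ℂ (H p)]

/-- The block diagonal operator `diag_p (W_p ⊗ I)`, written with orthonormal bases of the
spaces `H p`; `blockDiag_tensorVecR` shows that it maps
`x ⊗ h` to `(W_p x) ⊗ h`. -/
def blockDiag (W : ∀ p, A.TildeR p →L[ℂ] A.TildeS p) : A.EnhR H →L[ℂ] A.EnhS H :=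
  ∑ p : A.Comp, ∑ i, A.tensorVecS p (stdOrthonormalBasis ℂ (H p) i) ∘L W p ∘L
    A.contractR p (stdOrthonormalBasis ℂ (H p) i)

/-- `diag_p (W_p ⊗ I)` maps `x ⊗ h` to `(W_p x) ⊗ h`. -/
theorem blockDiag_tensorVecR (W : ∀ p, A.TildeR p →L[ℂ] A.TildeS p) (p : A.Comp) (h : H p)
    (x : A.TildeR p) :
    A.blockDiag (H := H) W (A.tensorVecR p h x) = A.tensorVecS p h (W p x) := by
  simp only [blockDiag, sum_apply, ContinuousLinearMap.comp_apply]
  rw [Finset.sum_eq_single p]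
  · simp only [contractR_tensorVecR, map_smul, tensorVecS, sum_apply,
      ContinuousLinearMap.comp_apply, Finset.smul_sum]
    rw [Finset.sum_comm]
    refine Finset.sum_congr rfl fun s _ => ?_
    rw [← sum_inner_smul_tensorVec h, map_sum]
    simp only [map_smul]
  · intro q _ hq
    refine Finset.sum_eq_zero fun i _ => ?_
    rw [contractR_tensorVecR_of_ne A hq, map_zero, map_zero]
  · intro hp
    exact absurd (Finset.mem_univ p) hp

end AdmissibleGraph

end

/-!
The inequality `μ ≤ μ̂` is algebra: if `T X = Y T` then `M T` is similar to `(X M Y⁻¹) T`, so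
`1 ∈ σ(M T)` forces `1 ≤ ‖X M Y⁻¹‖ ‖T‖` (`one_le_enorm_mul_enorm`). Everything else follows, after
rescaling `M`, from the cycle (1) ⇒ (1') ⇒ (2') ⇒ (2) ⇒ (1). Step (1) ⇒ (1') holds because
`diag_p (W_p ⊗ I)` belongs to the uncertainty set and its norm is at most `max_p ‖W_p‖`; step (2')
⇒ (2) takes `X` and `Y` to be the ampliations of square roots `u_p` of `Γ_p = u_p* u_p`.

The substance is (1') ⇒ (2'), a lossless S-procedure. For a vector `f` of `H_S` let `f_{p,i}` be
its coefficients in an orthonormal basis of `H p`, and let `gramS f` be the family over `p` of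
their Gram matrices; `gramR (M f)` is the same on the range side. Two facts are combined.

* If the Gram matrices of `f` are dominated by those of `M f` up to a small error, then there are
  contractions `W_p` that almost map the coefficients of `M f` to those of `f`; this is an
  approximate form of Douglas' lemma (`exists_contraction_of_norm_sq_le`). Given a sequence of
  such vectors with errors tending to zero, shift-invariance allows one to move them to disjoint
  time windows, where the corresponding contractions become blocks of one contraction
  (`exists_contraction_of_windows`), and for that perturbation `1 - Δ M` is not bounded below.
  Hence (1') gives a `δ > 0` such that only `f = 0` satisfies the domination up to `δ ‖f‖²`
  (`AdmissibleGraph.exists_pos_forall_gramLE`).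
* The set of all `gramR (M f) - gramS f + δ ‖f‖² I` has convex closure, because the value at
  `f + Vⁿ g` tends to the sum of the values at `f` and `g` (`AdmissibleGraph.tendsto_defect`). By
  the first fact it avoids the open convex set of the families with positive definite real part,
  and the Hahn–Banach theorem provides a separating functional
  (`AdmissibleGraph.exists_separating_functional`).

The functional is positive on positive semidefinite families, so it is represented by positive
operators on the spaces `H p`; adding a small multiple of the identity to them gives the `Γ_p` of
(2') (`AdmissibleGraph.exists_multipliers`).
-/

noncomputable section

/-! ### An approximate Douglas lemma -/

open ContinuousLinearMap in
/-- An approximate form of Douglas' lemma: `W = B (A* A + ε²)⁻¹ A*` is a contraction that maps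
`A c` to `B c` up to an error `ε ‖c‖`. -/
theorem exists_contraction_of_norm_sq_le {E X Y : Type*}
    [NormedAddCommGroup E] [InnerProductSpace ℂ E] [FiniteDimensional ℂ E] [CompleteSpace E]
    [NormedAddCommGroup X] [InnerProductSpace ℂ X] [CompleteSpace X]
    [NormedAddCommGroup Y] [InnerProductSpace ℂ Y]
    (A : E →L[ℂ] X) (B : E →L[ℂ] Y) {ε : ℝ} (hε : 0 < ε)
    (h : ∀ c, ‖B c‖ ^ 2 ≤ ‖A c‖ ^ 2 + ε ^ 2 * ‖c‖ ^ 2) :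
    ∃ W : X →L[ℂ] Y, ‖W‖ ≤ 1 ∧ ∀ c, ‖W (A c) - B c‖ ≤ ε * ‖c‖ := by
  set T : E →L[ℂ] E := adjoint A ∘L A + ((ε : ℂ) ^ 2) • ContinuousLinearMap.id ℂ E with hT
  have hTc : ∀ c, (inner ℂ c (T c)).re = ‖A c‖ ^ 2 + ε ^ 2 * ‖c‖ ^ 2 := by
    intro c
    have e1 : inner ℂ c (T c) = ((‖A c‖ ^ 2 + ε ^ 2 * ‖c‖ ^ 2 : ℝ) : ℂ) := by
      simp [hT, adjoint_inner_right, inner_self_eq_norm_sq_to_K]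
    rw [e1, Complex.ofReal_re]
  have hinj : Function.Injective (T : E →ₗ[ℂ] E) := by
    rw [injective_iff_map_eq_zero]
    intro c hc
    have h1 := hTc c
    have hc' : T c = 0 := hc
    rw [hc', inner_zero_right, Complex.zero_re] at h1
    have : ε ^ 2 * ‖c‖ ^ 2 ≤ 0 := by nlinarith [sq_nonneg ‖A c‖]
    have : ‖c‖ ^ 2 ≤ 0 := by
      by_contra hh
      push Not at hh
      nlinarith [mul_pos (pow_pos hε 2) hh]
    simpa using le_antisymm this (sq_nonneg _)
  let e := LinearEquiv.ofInjectiveEndo (T : E →ₗ[ℂ] E) hinj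
  let S : E →L[ℂ] E := LinearMap.toContinuousLinearMap (e.symm : E →ₗ[ℂ] E)
  have hTS : ∀ c, T (S c) = c := fun c => e.apply_symm_apply c
  have hST : ∀ c, S (T c) = c := fun c => e.symm_apply_apply c
  refine ⟨B ∘L S ∘L adjoint A, ?_, ?_⟩
  · refine ContinuousLinearMap.opNorm_le_bound _ zero_le_one fun x => ?_
    rw [one_mul]
    set c := S (adjoint A x) with hc
    have h1 := hTc c
    rw [hc, hTS, ← hc, adjoint_inner_right] at h1
    have h2 : (inner ℂ (A c) x).re ≤ ‖A c‖ * ‖x‖ :=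
      (Complex.re_le_norm _).trans (norm_inner_le_norm _ _)
    have h3 := h c
    have h4 : ‖A c‖ ≤ ‖x‖ := by
      by_contra hh
      push Not at hh
      nlinarith [norm_nonneg x, mul_nonneg (sq_nonneg ε) (sq_nonneg ‖c‖)]
    change ‖B c‖ ≤ ‖x‖
    refine abs_le_of_sq_le_sq' ?_ (norm_nonneg x) |>.2
    nlinarith [norm_nonneg x]
  · intro c
    set d := S c with hd
    -- The error is `-ε² B d` with `d = (A* A + ε²)⁻¹ c`.
    have h0 : S (adjoint A (A c)) = c - ((ε : ℂ) ^ 2) • d := by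
      have h5 := hST c
      simp only [hT, add_apply, ContinuousLinearMap.comp_apply, map_add] at h5
      rw [eq_sub_iff_add_eq]
      refine Eq.trans ?_ h5
      simp [hd]
    have h1 := hTc d
    rw [hd, hTS, ← hd] at h1
    have h2 : (inner ℂ d c).re ≤ ‖d‖ * ‖c‖ :=
      (Complex.re_le_norm _).trans (norm_inner_le_norm _ _)
    have h3 := h d
    have h6 : ε ^ 2 * ‖d‖ ≤ ‖c‖ := by
      by_contra hh
      push Not at hh
      have hdpos : 0 < ‖d‖ := by
        by_contra h7
        have : ‖d‖ = 0 := le_antisymm (not_lt.mp h7) (norm_nonneg d)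
        rw [this] at hh
        linarith [norm_nonneg c]
      nlinarith [sq_nonneg ‖A d‖]
    have h7 : (B ∘L S ∘L adjoint A) (A c) - B c = -(((ε : ℂ) ^ 2) • B d) := by
      simp [h0]
    rw [h7, norm_neg, norm_smul, norm_pow, Complex.norm_real, Real.norm_of_nonneg hε.le]
    refine abs_le_of_sq_le_sq' ?_ (by positivity) |>.2
    have h8 : ‖B d‖ ^ 2 ≤ ‖d‖ * ‖c‖ := by linarith
    calc (ε ^ 2 * ‖B d‖) ^ 2 = ε ^ 4 * ‖B d‖ ^ 2 := by ring
      _ ≤ ε ^ 4 * (‖d‖ * ‖c‖) := by gcongr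
      _ = (ε ^ 2 * ‖d‖) * (ε ^ 2 * ‖c‖) := by ring
      _ ≤ ‖c‖ * (ε ^ 2 * ‖c‖) := by gcongr
      _ = (ε * ‖c‖) ^ 2 := by ring

/-! ### Windows of an isometry -/

section Window

variable {K : Type*} [NormedAddCommGroup K] [InnerProductSpace ℂ K] [CompleteSpace K]

/-- The orthogonal projection `1 - Vᴸ V*ᴸ` onto the orthogonal complement of the range of `Vᴸ`,
for an isometry `V`. For a unilateral shift it cuts a sequence off after its first `L` entries. -/
def window (V : K →L[ℂ] K) (L : ℕ) : K →L[ℂ] K := 1 - V ^ L * star V ^ L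

theorem star_window (V : K →L[ℂ] K) (L : ℕ) : star (window V L) = window V L := by
  simp [window]

theorem inner_star_left (T : K →L[ℂ] K) (x y : K) : inner ℂ (star T x) y = inner ℂ x (T y) :=
  ContinuousLinearMap.adjoint_inner_left T y x

variable {V : K →L[ℂ] K}

theorem star_pow_mul_pow (hV : star V * V = 1) (n : ℕ) : star V ^ n * V ^ n = 1 :=
  pow_mul_pow_eq_one n hV

theorem star_pow_mul_pow_add (hV : star V * V = 1) (n k : ℕ) :
    star V ^ n * V ^ (n + k) = V ^ k := by
  rw [pow_add, ← mul_assoc, star_pow_mul_pow hV, one_mul]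

theorem star_pow_add_mul_pow (hV : star V * V = 1) (n k : ℕ) :
    star V ^ (n + k) * V ^ n = star V ^ k := by
  rw [add_comm, pow_add, mul_assoc, star_pow_mul_pow hV, mul_one]

theorem norm_pow_apply (hV : star V * V = 1) (n : ℕ) (x : K) : ‖(V ^ n) x‖ = ‖x‖ := by
  have h : inner ℂ ((V ^ n) x) ((V ^ n) x) = inner ℂ x x := by
    rw [← inner_star_left, star_pow, ← mul_apply_eq_comp, star_pow_mul_pow hV]
    rfl
  rw [inner_self_eq_norm_sq_to_K, inner_self_eq_norm_sq_to_K] at h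
  have h' : ‖(V ^ n) x‖ ^ 2 = ‖x‖ ^ 2 := by exact_mod_cast h
  exact (sq_eq_sq₀ (norm_nonneg _) (norm_nonneg _)).mp h'

theorem window_mul_window (hV : star V * V = 1) (L : ℕ) : window V L * window V L = window V L := by
  have : V ^ L * star V ^ L * (V ^ L * star V ^ L) = V ^ L * star V ^ L := by
    rw [mul_assoc, ← mul_assoc (star V ^ L), star_pow_mul_pow hV, one_mul]
  simp only [window, mul_sub, sub_mul, this, one_mul, mul_one]
  simp

theorem window_mul_pow (hV : star V * V = 1) {L k : ℕ} (h : L ≤ k) : window V L * V ^ k = 0 := by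
  obtain ⟨j, rfl⟩ := Nat.exists_eq_add_of_le h
  rw [window, sub_mul, mul_assoc, star_pow_mul_pow_add hV, one_mul, ← pow_add, sub_self]

theorem star_pow_mul_window (hV : star V * V = 1) {L k : ℕ} (h : L ≤ k) :
    star V ^ k * window V L = 0 := by
  have := congrArg star (window_mul_pow hV h)
  rwa [star_mul, star_window, star_zero, star_pow] at this

theorem norm_sq_window_apply (hV : star V * V = 1) (L : ℕ) (x : K) :
    ‖window V L x‖ ^ 2 = ‖x‖ ^ 2 - ‖(star V ^ L) x‖ ^ 2 := by
  have h1 : inner ℂ (window V L x) (window V L x) = inner ℂ x x -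
      inner ℂ ((star V ^ L) x) ((star V ^ L) x) := by
    conv_lhs => rw [← star_window V L, inner_star_left, star_window,
      ← mul_apply_eq_comp, window_mul_window hV]
    rw [← star_pow, inner_star_left, star_pow, window, sub_apply, inner_sub_right]
    rfl
  simp only [inner_self_eq_norm_sq_to_K] at h1
  exact_mod_cast h1

theorem norm_window_apply_le (hV : star V * V = 1) (L : ℕ) (x : K) : ‖window V L x‖ ≤ ‖x‖ := by
  have := norm_sq_window_apply hV L x
  refine abs_le_of_sq_le_sq' ?_ (norm_nonneg x) |>.2
  nlinarith [sq_nonneg ‖(star V ^ L) x‖]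

theorem norm_sub_window_apply (hV : star V * V = 1) (L : ℕ) (x : K) :
    ‖x - window V L x‖ = ‖(star V ^ L) x‖ := by
  have : x - window V L x = (V ^ L) ((star V ^ L) x) := by
    simp [window, mul_apply_eq_comp]
  rw [this, norm_pow_apply hV]

/-- The left end points of consecutive windows of lengths `L 0, L 1, …`. -/
def windowStart (L : ℕ → ℕ) (n : ℕ) : ℕ := ∑ m ∈ Finset.range n, L m

theorem windowStart_succ (L : ℕ → ℕ) (n : ℕ) :
    windowStart L (n + 1) = windowStart L n + L n := Finset.sum_range_succ _ _

theorem windowStart_add_le (L : ℕ → ℕ) {m n : ℕ} (h : m < n) :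
    windowStart L m + L m ≤ windowStart L n := by
  rw [← windowStart_succ]
  exact Finset.sum_le_sum_of_subset (Finset.range_mono h)

/-- The squared norms of the pieces of a vector in consecutive windows telescope. -/
theorem sum_norm_sq_window (hV : star V * V = 1) (L : ℕ → ℕ) (x : K) (N : ℕ) :
    ∑ n ∈ Finset.range N, ‖window V (L n) ((star V ^ windowStart L n) x)‖ ^ 2 =
      ‖x‖ ^ 2 - ‖(star V ^ windowStart L N) x‖ ^ 2 := by
  induction N with
  | zero => simp [windowStart]
  | succ N ih =>
    rw [Finset.sum_range_succ, ih, norm_sq_window_apply hV, windowStart_succ,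
      add_comm (windowStart L N),
      pow_add, mul_apply_eq_comp]
    ring

theorem sum_norm_rpow_window_le (hV : star V * V = 1) (L : ℕ → ℕ) (x : K) (s : Finset ℕ) :
    ∑ n ∈ s, ‖window V (L n) ((star V ^ windowStart L n) x)‖ ^ (2 : ℝ≥0∞).toReal ≤
      ‖x‖ ^ (2 : ℝ≥0∞).toReal := by
  obtain ⟨N, hN⟩ := s.exists_nat_subset_range
  simp only [ENNReal.toReal_ofNat, Real.rpow_ofNat]
  refine (Finset.sum_le_sum_of_subset_of_nonneg hN fun _ _ _ => by positivity).trans ?_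
  rw [sum_norm_sq_window hV]
  linarith [sq_nonneg ‖(star V ^ windowStart L N) x‖]

/-- The contraction that cuts a vector into its pieces in consecutive windows, each moved back to
the start. -/
def cut (hV : star V * V = 1) (L : ℕ → ℕ) : K →L[ℂ] Ell2 K :=
  LinearMap.mkContinuous
    { toFun := fun x => ⟨fun n => window V (L n) ((star V ^ windowStart L n) x),
        memℓp_gen' (sum_norm_rpow_window_le hV L x)⟩
      map_add' := fun x y => by
        ext n
        change window V (L n) ((star V ^ windowStart L n) (x + y)) = _ + _
        simp only [map_add]
      map_smul' := fun c x => by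
        ext n
        change window V (L n) ((star V ^ windowStart L n) (c • x)) = c • _
        simp only [map_smul] }
    1 fun x => by
      rw [one_mul]
      exact lp.norm_le_of_forall_sum_le (by norm_num) (norm_nonneg x)
        (sum_norm_rpow_window_le hV L x)

theorem cut_apply (hV : star V * V = 1) (L : ℕ → ℕ) (x : K) (n : ℕ) :
    cut hV L x n = window V (L n) ((star V ^ windowStart L n) x) := rfl

theorem norm_cut_le (hV : star V * V = 1) (L : ℕ → ℕ) : ‖cut hV L‖ ≤ 1 :=
  LinearMap.mkContinuous_norm_le _ zero_le_one _

/-- A vector that lives in the `n`-th window has only one piece. -/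
theorem cut_pow_window (hV : star V * V = 1) (L : ℕ → ℕ) (n : ℕ) (x : K) :
    cut hV L ((V ^ windowStart L n) (window V (L n) x)) =
      lp.single 2 n (window V (L n) x) := by
  ext m
  rw [cut_apply, lp.single_apply]
  rcases lt_trichotomy m n with h | rfl | h
  · have hle := windowStart_add_le L h
    obtain ⟨j, hj⟩ := Nat.exists_eq_add_of_le ((Nat.le_add_right _ _).trans hle)
    rw [Pi.single_eq_of_ne h.ne, ← mul_apply_eq_comp (star V ^ _), hj,
      star_pow_mul_pow_add hV, ← mul_apply_eq_comp, window_mul_pow hV (by omega)]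
    rfl
  · rw [Pi.single_eq_same, ← mul_apply_eq_comp (star V ^ _), star_pow_mul_pow hV,
      one_apply_eq_self, ← mul_apply_eq_comp, window_mul_window hV]
  · have hle := windowStart_add_le L h
    obtain ⟨j, hj⟩ := Nat.exists_eq_add_of_le ((Nat.le_add_right _ _).trans hle)
    rw [Pi.single_eq_of_ne h.ne', ← mul_apply_eq_comp (star V ^ _), hj,
      star_pow_add_mul_pow hV, ← mul_apply_eq_comp (star V ^ _),
      star_pow_mul_window hV (by omega)]
    simp

theorem adjoint_cut_single (hV : star V * V = 1) (L : ℕ → ℕ) (n : ℕ) (y : K) :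
    ContinuousLinearMap.adjoint (cut hV L) (lp.single 2 n y) =
      (V ^ windowStart L n) (window V (L n) y) := by
  refine ext_inner_left ℂ fun x => ?_
  rw [ContinuousLinearMap.adjoint_inner_right, lp.inner_single_right, cut_apply,
    ← star_window V (L n), inner_star_left, star_window, ← star_pow, inner_star_left]

end Window

theorem lp_mapCLM_single {X Y : Type*} [NormedAddCommGroup X] [InnerProductSpace ℂ X]
    [NormedAddCommGroup Y] [InnerProductSpace ℂ Y] (W : ℕ → X →L[ℂ] Y)
    (hW : ∀ n, ‖W n‖ ≤ 1) (n : ℕ) (x : X) :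
    lp.mapCLM 2 W zero_le_one hW (lp.single 2 n x) = lp.single 2 n (W n x) := by
  ext m
  change W m ((lp.single 2 n x : Ell2 X) m) = _
  rw [lp.single_apply, lp.single_apply]
  rcases eq_or_ne m n with rfl | h
  · simp
  · simp [h]

open ContinuousLinearMap in
/-- Countably many contractions, compressed to initial windows and moved to disjoint windows, are
the blocks of a single contraction. -/
theorem exists_contraction_of_windows {X Y : Type*}
    [NormedAddCommGroup X] [InnerProductSpace ℂ X] [CompleteSpace X]
    [NormedAddCommGroup Y] [InnerProductSpace ℂ Y] [CompleteSpace Y]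
    {V : X →L[ℂ] X} {U : Y →L[ℂ] Y} (hV : star V * V = 1) (hU : star U * U = 1)
    (W : ℕ → X →L[ℂ] Y) (hW : ∀ n, ‖W n‖ ≤ 1) (L : ℕ → ℕ) :
    ∃ T : X →L[ℂ] Y, ‖T‖ ≤ 1 ∧ ∀ n x, T ((V ^ windowStart L n) (window V (L n) x)) =
      (U ^ windowStart L n) (window U (L n) (W n (window V (L n) x))) := by
  -- Cut into pieces, apply `W n` to the `n`-th piece, and put the pieces back into their windows.
  refine ⟨adjoint (cut hU L) ∘L lp.mapCLM 2 W zero_le_one hW ∘L cut hV L, ?_, fun n x => ?_⟩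
  · have h1 : ‖adjoint (cut hU L)‖ ≤ 1 := by
      rw [LinearIsometryEquiv.norm_map]
      exact norm_cut_le hU L
    have h2 : ‖lp.mapCLM 2 W zero_le_one hW‖ ≤ 1 := lp.norm_mapCLM_le 2 W zero_le_one hW
    refine (opNorm_comp_le _ _).trans (mul_le_one₀ h1 (norm_nonneg _) ?_)
    exact (opNorm_comp_le _ _).trans (mul_le_one₀ h2 (norm_nonneg _) (norm_cut_le hV L))
  · rw [ContinuousLinearMap.comp_apply, ContinuousLinearMap.comp_apply, cut_pow_window,
      lp_mapCLM_single, adjoint_cut_single]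

/-- If a contraction `W` almost maps `x` to `y`, then its copy in a window, as provided by
`exists_contraction_of_windows`, almost maps the translate of `x` to the translate of `y`. -/
theorem norm_block_sub_le {X Y : Type*}
    [NormedAddCommGroup X] [InnerProductSpace ℂ X] [CompleteSpace X]
    [NormedAddCommGroup Y] [InnerProductSpace ℂ Y] [CompleteSpace Y]
    {V : X →L[ℂ] X} {U : Y →L[ℂ] Y} (hV : star V * V = 1) (hU : star U * U = 1)
    {W T : X →L[ℂ] Y} (hW : ‖W‖ ≤ 1) (hT : ‖T‖ ≤ 1) {a L : ℕ} {x : X} {y : Y}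
    (h : T ((V ^ a) (window V L x)) = (U ^ a) (window U L (W (window V L x))))
    {ε : ℝ} (hx : ‖(star V ^ L) x‖ ≤ ε) (hy : ‖(star U ^ L) y‖ ≤ ε) (hxy : ‖W x - y‖ ≤ ε) :
    ‖T ((V ^ a) x) - (U ^ a) y‖ ≤ 4 * ε := by
  have e : T ((V ^ a) x) - (U ^ a) y =
      T ((V ^ a) (x - window V L x)) - (U ^ a) (window U L (W (x - window V L x))) +
        (U ^ a) (window U L (W x - y)) - (U ^ a) (y - window U L y) := by
    simp only [map_sub, h]
    abel
  have hTle : ∀ z, ‖T z‖ ≤ ‖z‖ := fun z => by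
    simpa using T.le_of_opNorm_le hT z
  have hWle : ∀ z, ‖W z‖ ≤ ‖z‖ := fun z => by
    simpa using W.le_of_opNorm_le hW z
  have h1 : ‖T ((V ^ a) (x - window V L x))‖ ≤ ε := by
    refine (hTle _).trans ?_
    rwa [norm_pow_apply hV, norm_sub_window_apply hV]
  have h2 : ‖(U ^ a) (window U L (W (x - window V L x)))‖ ≤ ε := by
    rw [norm_pow_apply hU]
    refine (norm_window_apply_le hU _ _).trans ((hWle _).trans ?_)
    rwa [norm_sub_window_apply hV]
  have h3 : ‖(U ^ a) (window U L (W x - y))‖ ≤ ε := by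
    rw [norm_pow_apply hU]
    exact (norm_window_apply_le hU _ _).trans hxy
  have h4 : ‖(U ^ a) (y - window U L y)‖ ≤ ε := by
    rw [norm_pow_apply hU]
    rwa [norm_sub_window_apply hU]
  rw [e]
  have := norm_sub_le (T ((V ^ a) (x - window V L x)) -
    (U ^ a) (window U L (W (x - window V L x))) + (U ^ a) (window U L (W x - y)))
    ((U ^ a) (y - window U L y))
  have := norm_add_le (T ((V ^ a) (x - window V L x)) - (U ^ a) (window U L (W (x - window V L x))))
    ((U ^ a) (window U L (W x - y)))
  have := norm_sub_le (T ((V ^ a) (x - window V L x)))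
    ((U ^ a) (window U L (W (x - window V L x))))
  linarith

/-! ### Coordinatewise operators on Hilbert space direct sums -/

section CoordMap

variable {ι : Type*} [Fintype ι] {E : ι → Type*}
  [∀ i, NormedAddCommGroup (E i)] [∀ i, InnerProductSpace ℂ (E i)]

theorem inner_sumEmb_left (i : ι) (a : E i) (f : PiLp 2 E) :
    inner ℂ (sumEmb E i a) f = inner ℂ a (f i) := by
  rw [PiLp.inner_apply, Finset.sum_eq_single i]
  · exact congrArg (fun z => inner ℂ z (f i)) (sumProj_sumEmb_same E i a)
  · intro j _ hj
    have : (sumEmb E i a).ofLp j = 0 := sumProj_sumEmb_of_ne E hj a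
    rw [this, inner_zero_left]
  · exact fun h => absurd (Finset.mem_univ i) h

/-- The direct sum of the operators `B i`. -/
def coordMap (B : ∀ i, E i →L[ℂ] E i) : PiLp 2 E →L[ℂ] PiLp 2 E :=
  ∑ i, sumEmb E i ∘L B i ∘L sumProj E i

theorem coordMap_apply (B : ∀ i, E i →L[ℂ] E i) (x : PiLp 2 E) (i : ι) :
    coordMap B x i = B i (x i) := by
  have h : sumProj E i (coordMap B x) = B i (x i) := by
    simp only [coordMap, sum_apply, ContinuousLinearMap.comp_apply, map_sum]
    rw [Finset.sum_eq_single i]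
    · exact sumProj_sumEmb_same E i _
    · exact fun j _ hj => sumProj_sumEmb_of_ne E hj.symm _
    · exact fun h => absurd (Finset.mem_univ i) h
  exact h

theorem coordMap_sumEmb (B : ∀ i, E i →L[ℂ] E i) (i : ι) (a : E i) :
    coordMap B (sumEmb E i a) = sumEmb E i (B i a) := by
  simp only [coordMap, sum_apply, ContinuousLinearMap.comp_apply]
  rw [Finset.sum_eq_single i]
  · rw [sumProj_sumEmb_same]
  · exact fun j _ hj => by rw [sumProj_sumEmb_of_ne E hj, map_zero, map_zero]
  · exact fun h => absurd (Finset.mem_univ i) h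

theorem coordMap_mul (B C : ∀ i, E i →L[ℂ] E i) :
    coordMap B * coordMap C = coordMap fun i => B i * C i := by
  ext x i
  simp [coordMap_apply]

theorem coordMap_one : coordMap (fun i => (1 : E i →L[ℂ] E i)) = 1 := by
  ext x i
  simp [coordMap_apply]

theorem coordMap_pow (B : ∀ i, E i →L[ℂ] E i) (n : ℕ) :
    coordMap B ^ n = coordMap fun i => B i ^ n := by
  induction n with
  | zero => simp [coordMap_one]
  | succ n ih => simp [pow_succ, ih, coordMap_mul]

theorem star_coordMap [∀ i, CompleteSpace (E i)] (B : ∀ i, E i →L[ℂ] E i) :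
    star (coordMap B) = coordMap fun i => star (B i) := by
  symm
  refine (ContinuousLinearMap.eq_adjoint_iff _ _).mpr fun x y => ?_
  simp only [PiLp.inner_apply, coordMap_apply, inner_star_left]

theorem tendsto_star_coordMap_pow [∀ i, CompleteSpace (E i)] {B : ∀ i, E i →L[ℂ] E i}
    (hB : ∀ i x, Filter.Tendsto (fun n => (star (B i) ^ n) x) Filter.atTop (nhds 0))
    (x : PiLp 2 E) :
    Filter.Tendsto (fun n => (star (coordMap B) ^ n) x) Filter.atTop (nhds 0) := by
  rw [tendsto_zero_iff_norm_tendsto_zero]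
  have h1 : ∀ n, ‖(star (coordMap B) ^ n) x‖ =
      √(∑ i, ‖(star (B i) ^ n) (x i)‖ ^ 2) := fun n => by
    rw [star_coordMap, coordMap_pow, PiLp.norm_eq_of_L2]
    simp only [coordMap_apply]
  simp only [h1]
  have h2 : Filter.Tendsto (fun n => ∑ i, ‖(star (B i) ^ n) (x i)‖ ^ 2) Filter.atTop
      (nhds (∑ _i : ι, 0 ^ 2)) :=
    tendsto_finsetSum _ fun i _ =>
      ((tendsto_zero_iff_norm_tendsto_zero.mp (hB i (x i))).pow 2)
  simpa using h2.sqrt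

end CoordMap

/-! ### Operators on `ℓ² ⊗ H` -/

section Ell2Lemmas

variable {H : Type*} [NormedAddCommGroup H] [InnerProductSpace ℂ H]

theorem inner_tensorVec_left (h : H) (x : Ell2 ℂ) (f : Ell2 H) :
    inner ℂ (tensorVec h x) f = inner ℂ x (idTensor (innerSL ℂ h) f) := by
  rw [lp.inner_eq_tsum, lp.inner_eq_tsum]
  refine tsum_congr fun n => ?_
  simp [inner_smul_left, mul_comm]

theorem idTensor_innerSL_shift (b : H) (f : Ell2 H) :
    idTensor (innerSL ℂ b) (shift f) = shift (idTensor (innerSL ℂ b) f) := by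
  ext n
  cases n <;> simp

/-- A vector of `ℓ² ⊗ H` is determined by its contractions against the vectors of `H`. -/
theorem ell2_ext_of_innerSL {f g : Ell2 H}
    (h : ∀ b : H, idTensor (innerSL ℂ b) f = idTensor (innerSL ℂ b) g) : f = g := by
  ext n
  refine ext_inner_left ℂ fun b => ?_
  have := congrArg (fun u : Ell2 ℂ => u n) (h b)
  simpa using this

theorem sum_inner_idTensor_innerSL {ι : Type*} [Fintype ι] (b : OrthonormalBasis ι ℂ H)
    (x y : Ell2 H) :
    ∑ i, inner ℂ (idTensor (innerSL ℂ (b i)) x) (idTensor (innerSL ℂ (b i)) y) =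
      inner ℂ x y := by
  have h := hasSum_sum (s := Finset.univ) fun i _ =>
    lp.hasSum_inner (𝕜 := ℂ) (idTensor (innerSL ℂ (b i)) x) (idTensor (innerSL ℂ (b i)) y)
  have e : (fun n => ∑ i, inner ℂ (idTensor (innerSL ℂ (b i)) x n)
      (idTensor (innerSL ℂ (b i)) y n)) = fun n => inner ℂ (x n) (y n) := by
    funext n
    rw [← b.sum_inner_mul_inner (x n) (y n)]
    refine Finset.sum_congr rfl fun i _ => ?_
    simp [mul_comm]
  rw [e] at h
  exact h.unique (lp.hasSum_inner x y)

variable [CompleteSpace H]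

theorem star_idTensor (B : H →L[ℂ] H) : star (idTensor B) = idTensor (star B) := by
  symm
  refine (ContinuousLinearMap.eq_adjoint_iff _ _).mpr fun x y => ?_
  rw [lp.inner_eq_tsum, lp.inner_eq_tsum]
  refine tsum_congr fun n => ?_
  rw [idTensor_apply, idTensor_apply, inner_star_left]

theorem idTensor_innerSL_idTensor (b : H) (B : H →L[ℂ] H) (f : Ell2 H) :
    idTensor (innerSL ℂ b) (idTensor B f) = idTensor (innerSL ℂ (star B b)) f := by
  ext n
  simp only [idTensor_apply, innerSL_apply_apply]
  rw [inner_star_left]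

theorem star_shift_apply (f : Ell2 H) (n : ℕ) : star (shift (H := H)) f n = f (n + 1) := by
  refine ext_inner_left ℂ fun (a : H) => ?_
  have h : shift (lp.single 2 n a : Ell2 H) = lp.single 2 (n + 1) a := by
    ext k
    cases k with
    | zero => simp [lp.single_apply]
    | succ k =>
      rw [shift_succ, lp.single_apply, lp.single_apply]
      rcases eq_or_ne k n with rfl | hk
      · simp
      · rw [Pi.single_eq_of_ne hk, Pi.single_eq_of_ne (by simpa using hk)]
  have h0 : ∀ g : Ell2 H, inner ℂ (lp.single 2 n a : Ell2 H) g = inner ℂ a (g n) :=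
    fun g => lp.inner_single_left n a g
  have h1 := h0 (star (shift (H := H)) f)
  have h2 : inner ℂ (lp.single 2 (n + 1) a : Ell2 H) f = inner ℂ a (f (n + 1)) :=
    lp.inner_single_left (n + 1) a f
  rw [← h1, ← h2, ← h]
  exact ContinuousLinearMap.adjoint_inner_right _ _ _

theorem star_shift_mul_shift : star (shift (H := H)) * shift = 1 := by
  ext f n
  simp [star_shift_apply]

theorem star_shift_pow_apply (f : Ell2 H) (n k : ℕ) :
    (star (shift (H := H)) ^ n) f k = f (k + n) := by
  induction n generalizing k with
  | zero => simp
  | succ n ih =>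
    rw [pow_succ', mul_apply_eq_comp, star_shift_apply, ih]
    rw [add_right_comm, add_assoc]

theorem tendsto_star_shift_pow (f : Ell2 H) :
    Filter.Tendsto (fun n => (star (shift (H := H)) ^ n) f) Filter.atTop (nhds 0) := by
  rw [tendsto_zero_iff_norm_tendsto_zero]
  have h1 : ∀ n, ‖(star (shift (H := H)) ^ n) f‖ = √(∑' k, ‖f (k + n)‖ ^ 2) := fun n => by
    have h := lp.norm_rpow_eq_tsum (p := 2) (by norm_num) ((star (shift (H := H)) ^ n) f)
    simp only [ENNReal.toReal_ofNat, Real.rpow_ofNat, star_shift_pow_apply] at h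
    rw [← h, Real.sqrt_sq (norm_nonneg _)]
  simp only [h1]
  simpa using (tendsto_sum_nat_add fun k => ‖f k‖ ^ 2).sqrt

end Ell2Lemmas

/-! ### Contraction against vectors of the coefficient spaces -/

section Contract

variable {P : Type*} {I : P → Type*} {H : P → Type*}
  [∀ p, NormedAddCommGroup (H p)] [∀ p, InnerProductSpace ℂ (H p)] [∀ p, Fintype (I p)]

variable (I) in
/-- The map `x ⊗ h ↦ ⟨h, b⟩ x` on the summand `ℓ² ⊗ ℂ^{I p} ⊗ H p`, and zero on the others. -/
def contract (p : P) (b : H p) :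
    PiLp 2 (fun v : Sigma I => Ell2 (H v.1)) →L[ℂ] PiLp 2 (fun _ : I p => Ell2 ℂ) :=
  ∑ v : I p, sumEmb (fun _ : I p => Ell2 ℂ) v ∘L idTensor (innerSL ℂ b) ∘L
    sumProj (fun v : Sigma I => Ell2 (H v.1)) ⟨p, v⟩

theorem contract_apply (p : P) (b : H p) (f : PiLp 2 (fun v : Sigma I => Ell2 (H v.1)))
    (v : I p) : contract I p b f v = idTensor (innerSL ℂ b) (f ⟨p, v⟩) := by
  have h : sumProj (fun _ : I p => Ell2 ℂ) v (contract I p b f) =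
      idTensor (innerSL ℂ b) (f ⟨p, v⟩) := by
    simp only [contract, sum_apply, ContinuousLinearMap.comp_apply, map_sum]
    rw [Finset.sum_eq_single v]
    · exact sumProj_sumEmb_same _ v _
    · exact fun j _ hj => sumProj_sumEmb_of_ne _ hj.symm _
    · exact fun h => absurd (Finset.mem_univ v) h
  exact h

/-- Contraction is conjugate linear in the vector that it is taken against. -/
theorem contract_sum {J : Type*} (s : Finset J) (p : P) (c : J → ℂ) (b : J → H p)
    (f : PiLp 2 (fun v : Sigma I => Ell2 (H v.1))) :
    contract I p (∑ j ∈ s, c j • b j) f = ∑ j ∈ s, star (c j) • contract I p (b j) f := by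
  ext v n
  have h : (∑ j ∈ s, star (c j) • contract I p (b j) f) v =
      ∑ j ∈ s, star (c j) • (contract I p (b j) f) v := by
    simp
  rw [h]
  simp only [contract_apply, lp.coeFn_sum, lp.coeFn_smul, Finset.sum_apply, Pi.smul_apply,
    idTensor_apply, innerSL_apply_apply, sum_inner, inner_smul_left, smul_eq_mul]
  rfl

-- The `Fintype` structure on `Sigma I` is a parameter: on the vertices of a graph it is
-- `Fintype.ofFinite`, not the instance of a sigma type.
variable [Fintype (Sigma I)]

variable (I) in
/-- The map `x ↦ x ⊗ h` into the summand `ℓ² ⊗ ℂ^{I p} ⊗ H p`. -/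
def expand (p : P) (h : H p) :
    PiLp 2 (fun _ : I p => Ell2 ℂ) →L[ℂ] PiLp 2 (fun v : Sigma I => Ell2 (H v.1)) :=
  ∑ v : I p, sumEmb (fun v : Sigma I => Ell2 (H v.1)) ⟨p, v⟩ ∘L tensorVec h ∘L
    sumProj (fun _ : I p => Ell2 ℂ) v

theorem inner_expand_left (p : P) (h : H p) (x : PiLp 2 (fun _ : I p => Ell2 ℂ))
    (f : PiLp 2 (fun v : Sigma I => Ell2 (H v.1))) :
    inner ℂ (expand I p h x) f = inner ℂ x (contract I p h f) := by
  simp only [expand, sum_apply, ContinuousLinearMap.comp_apply, sum_inner, inner_sumEmb_left,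
    inner_tensorVec_left]
  rw [PiLp.inner_apply]
  simp only [contract_apply]
  rfl

theorem contract_coordMap_shift (p : P) (b : H p)
    (f : PiLp 2 (fun v : Sigma I => Ell2 (H v.1))) :
    contract I p b (coordMap (fun _ => shift) f) =
      coordMap (fun _ => shift) (contract I p b f) := by
  ext v : 1
  rw [contract_apply, coordMap_apply, coordMap_apply, contract_apply, idTensor_innerSL_shift]

theorem contract_coordMap_idTensor [∀ p, CompleteSpace (H p)] (Γ : ∀ p, H p →L[ℂ] H p) (p : P)
    (b : H p) (f : PiLp 2 (fun v : Sigma I => Ell2 (H v.1))) :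
    contract I p b (coordMap (fun v => idTensor (Γ v.1)) f) =
      contract I p (star (Γ p) b) f := by
  ext v : 1
  rw [contract_apply, coordMap_apply, contract_apply, idTensor_innerSL_idTensor]

/-- Parseval's identity for the coefficients in orthonormal bases of the spaces `H p`. -/
theorem sum_inner_contract [Fintype P] {J : P → Type*} [∀ p, Fintype (J p)]
    (b : ∀ p, OrthonormalBasis (J p) ℂ (H p))
    (x y : PiLp 2 (fun v : Sigma I => Ell2 (H v.1))) :
    ∑ p, ∑ i, inner ℂ (contract I p (b p i) x) (contract I p (b p i) y) = inner ℂ x y := by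
  have h : inner ℂ x y = ∑ p, ∑ v : I p, inner ℂ (x ⟨p, v⟩) (y ⟨p, v⟩) := by
    rw [PiLp.inner_apply, ← Fintype.sum_sigma' fun p v => inner ℂ (x ⟨p, v⟩) (y ⟨p, v⟩)]
    exact Finset.sum_congr (by ext; simp) fun _ _ => rfl
  rw [h]
  refine Finset.sum_congr rfl fun p _ => ?_
  simp only [PiLp.inner_apply, contract_apply]
  rw [Finset.sum_comm]
  exact Finset.sum_congr rfl fun v _ => sum_inner_idTensor_innerSL (b p) _ _

end Contract

theorem star_coordMap_shift_mul {ι : Type*} [Fintype ι] {E : ι → Type*}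
    [∀ i, NormedAddCommGroup (E i)] [∀ i, InnerProductSpace ℂ (E i)] [∀ i, CompleteSpace (E i)] :
    star (coordMap fun i => shift (H := E i)) * coordMap (fun i => shift (H := E i)) = 1 := by
  rw [star_coordMap, coordMap_mul]
  simp only [star_shift_mul_shift]
  exact coordMap_one

namespace AdmissibleGraph

variable {V : Type*} [Finite V] (A : AdmissibleGraph V) {H : A.Comp → Type*}
  [∀ p, NormedAddCommGroup (H p)] [∀ p, InnerProductSpace ℂ (H p)]

/-! ### The graph operators in coordinates -/

/-- The adjoint of `tensorVecS p b`: the map `x ⊗ h ↦ ⟨h, b⟩ x` on the summand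
`ℓ² ⊗ ℂ^{S_p} ⊗ H p`, and zero on the other summands. -/
def contractS (p : A.Comp) (b : H p) : A.EnhS H →L[ℂ] A.TildeS p := contract A.SrcOf p b

theorem inner_tensorVecS_left (p : A.Comp) (h : H p) (x : A.TildeS p) (f : A.EnhS H) :
    inner ℂ (A.tensorVecS p h x) f = inner ℂ x (A.contractS p h f) :=
  letI : Fintype (Sigma A.SrcOf) := inferInstanceAs (Fintype A.Src)
  inner_expand_left (I := A.SrcOf) p h x f

theorem contractS_sum {J : Type*} (s : Finset J) (p : A.Comp) (c : J → ℂ) (b : J → H p)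
    (f : A.EnhS H) :
    A.contractS p (∑ j ∈ s, c j • b j) f = ∑ j ∈ s, star (c j) • A.contractS p (b j) f :=
  contract_sum (I := A.SrcOf) s p c b f

theorem contractR_sum {J : Type*} (s : Finset J) (p : A.Comp) (c : J → ℂ) (b : J → H p)
    (f : A.EnhR H) :
    A.contractR p (∑ j ∈ s, c j • b j) f = ∑ j ∈ s, star (c j) • A.contractR p (b j) f :=
  contract_sum (I := A.RngOf) s p c b f

/-- The unilateral shift on `ℓ² ⊗ ℂ^{S_p}`. -/
def shiftTildeS (p : A.Comp) : A.TildeS p →L[ℂ] A.TildeS p := coordMap fun _ => shift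

/-- The unilateral shift on `ℓ² ⊗ ℂ^{R_p}`. -/
def shiftTildeR (p : A.Comp) : A.TildeR p →L[ℂ] A.TildeR p := coordMap fun _ => shift

theorem star_shiftTildeS_mul (p : A.Comp) : star (A.shiftTildeS p) * A.shiftTildeS p = 1 :=
  star_coordMap_shift_mul

theorem star_shiftTildeR_mul (p : A.Comp) : star (A.shiftTildeR p) * A.shiftTildeR p = 1 :=
  star_coordMap_shift_mul

theorem tendsto_star_shiftTildeS_pow (p : A.Comp) (x : A.TildeS p) :
    Filter.Tendsto (fun n => (star (A.shiftTildeS p) ^ n) x) Filter.atTop (nhds 0) :=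
  tendsto_star_coordMap_pow (fun _ => tendsto_star_shift_pow) x

theorem tendsto_star_shiftTildeR_pow (p : A.Comp) (x : A.TildeR p) :
    Filter.Tendsto (fun n => (star (A.shiftTildeR p) ^ n) x) Filter.atTop (nhds 0) :=
  tendsto_star_coordMap_pow (fun _ => tendsto_star_shift_pow) x

variable (H) in
/-- The shift `V_S`. -/
def shiftS : A.EnhS H →L[ℂ] A.EnhS H := A.diagS fun _ => shift

variable (H) in
/-- The shift `V_R`. -/
def shiftR : A.EnhR H →L[ℂ] A.EnhR H := A.diagR fun _ => shift

theorem contractS_shiftS_pow (p : A.Comp) (b : H p) (n : ℕ) (f : A.EnhS H) :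
    A.contractS p b ((A.shiftS H ^ n) f) = (A.shiftTildeS p ^ n) (A.contractS p b f) := by
  let _ : Fintype (Sigma A.SrcOf) := inferInstanceAs (Fintype A.Src)
  induction n with
  | zero => rfl
  | succ n ih =>
    rw [pow_succ', pow_succ', mul_apply_eq_comp, mul_apply_eq_comp, ← ih]
    exact contract_coordMap_shift (I := A.SrcOf) p b _

theorem contractR_shiftR_pow (p : A.Comp) (b : H p) (n : ℕ) (f : A.EnhR H) :
    A.contractR p b ((A.shiftR H ^ n) f) = (A.shiftTildeR p ^ n) (A.contractR p b f) := by
  let _ : Fintype (Sigma A.RngOf) := inferInstanceAs (Fintype A.Rng)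
  induction n with
  | zero => rfl
  | succ n ih =>
    rw [pow_succ', pow_succ', mul_apply_eq_comp, mul_apply_eq_comp, ← ih]
    exact contract_coordMap_shift (I := A.RngOf) p b _

theorem map_shiftS_pow {M : A.EnhS H →L[ℂ] A.EnhR H} (hM : A.ShiftInvariant M) (n : ℕ)
    (f : A.EnhS H) : M ((A.shiftS H ^ n) f) = (A.shiftR H ^ n) (M f) := by
  induction n with
  | zero => rfl
  | succ n ih =>
    rw [pow_succ', pow_succ', mul_apply_eq_comp, mul_apply_eq_comp, ← ih]
    exact (DFunLike.congr_fun hM _).symm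

variable [∀ p, FiniteDimensional ℂ (H p)]

theorem contractS_diagS_idTensor (Γ : ∀ p, H p →L[ℂ] H p) (p : A.Comp) (b : H p)
    (f : A.EnhS H) : A.contractS p b (A.diagS (fun p => idTensor (Γ p)) f) =
      A.contractS p (star (Γ p) b) f :=
  letI : Fintype (Sigma A.SrcOf) := inferInstanceAs (Fintype A.Src)
  contract_coordMap_idTensor (I := A.SrcOf) Γ p b f

theorem contractR_diagR_idTensor (Γ : ∀ p, H p →L[ℂ] H p) (p : A.Comp) (b : H p)
    (f : A.EnhR H) : A.contractR p b (A.diagR (fun p => idTensor (Γ p)) f) =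
      A.contractR p (star (Γ p) b) f :=
  letI : Fintype (Sigma A.RngOf) := inferInstanceAs (Fintype A.Rng)
  contract_coordMap_idTensor (I := A.RngOf) Γ p b f

/-- The coefficient of a vector of `H_S` at the `i`-th basis vector of `H p`. -/
def coefS (p : A.Comp) (i : Fin (Module.finrank ℂ (H p))) : A.EnhS H →L[ℂ] A.TildeS p :=
  A.contractS p (stdOrthonormalBasis ℂ (H p) i)

/-- The coefficient of a vector of `H_R` at the `i`-th basis vector of `H p`. -/
def coefR (p : A.Comp) (i : Fin (Module.finrank ℂ (H p))) : A.EnhR H →L[ℂ] A.TildeR p :=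
  A.contractR p (stdOrthonormalBasis ℂ (H p) i)

theorem sum_inner_coefS (x y : A.EnhS H) :
    ∑ p, ∑ i, inner ℂ (A.coefS p i x) (A.coefS p i y) = inner ℂ x y :=
  letI : Fintype (Sigma A.SrcOf) := inferInstanceAs (Fintype A.Src)
  sum_inner_contract (I := A.SrcOf) (fun p => stdOrthonormalBasis ℂ (H p)) x y

theorem sum_inner_coefR (x y : A.EnhR H) :
    ∑ p, ∑ i, inner ℂ (A.coefR p i x) (A.coefR p i y) = inner ℂ x y :=
  letI : Fintype (Sigma A.RngOf) := inferInstanceAs (Fintype A.Rng)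
  sum_inner_contract (I := A.RngOf) (fun p => stdOrthonormalBasis ℂ (H p)) x y

theorem sum_norm_sq_coefS (x : A.EnhS H) : ∑ p, ∑ i, ‖A.coefS p i x‖ ^ 2 = ‖x‖ ^ 2 := by
  have h := A.sum_inner_coefS x x
  simp only [inner_self_eq_norm_sq_to_K] at h
  exact_mod_cast h

theorem sum_norm_sq_coefR (x : A.EnhR H) : ∑ p, ∑ i, ‖A.coefR p i x‖ ^ 2 = ‖x‖ ^ 2 := by
  have h := A.sum_inner_coefR x x
  simp only [inner_self_eq_norm_sq_to_K] at h
  exact_mod_cast h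

/-- The expansion of a vector of `H_S` in orthonormal bases of the spaces `H p`. -/
theorem sum_tensorVecS_coefS (f : A.EnhS H) :
    ∑ p, ∑ i, A.tensorVecS p (stdOrthonormalBasis ℂ (H p) i) (A.coefS p i f) = f := by
  refine ext_inner_right ℂ fun x => ?_
  rw [← A.sum_inner_coefS f x]
  simp only [sum_inner, inner_tensorVecS_left]
  rfl

theorem blockDiag_apply (W : ∀ p, A.TildeR p →L[ℂ] A.TildeS p) (g : A.EnhR H) :
    A.blockDiag W g =
      ∑ p, ∑ i, A.tensorVecS p (stdOrthonormalBasis ℂ (H p) i) (W p (A.coefR p i g)) := by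
  simp only [blockDiag, sum_apply, ContinuousLinearMap.comp_apply]
  rfl

theorem norm_shiftS_pow (n : ℕ) (f : A.EnhS H) : ‖(A.shiftS H ^ n) f‖ = ‖f‖ :=
  norm_pow_apply star_coordMap_shift_mul n f

/-- The ampliation `W_p ⊗ I` does not increase norms, and the summands over `p` are orthogonal. -/
theorem norm_blockDiag_le {ρ : ℝ} (hρ : 0 ≤ ρ) {W : ∀ p, A.TildeR p →L[ℂ] A.TildeS p}
    (hW : ∀ p, ‖W p‖ ≤ ρ) : ‖A.blockDiag (H := H) W‖ ≤ ρ := by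
  refine ContinuousLinearMap.opNorm_le_bound _ hρ fun g => ?_
  set z := A.blockDiag W g with hz
  have h1 : inner ℂ z z = ∑ p, ∑ i, inner ℂ (W p (A.coefR p i g)) (A.coefS p i z) := by
    nth_rw 1 [hz]
    rw [blockDiag_apply]
    simp only [sum_inner, inner_tensorVecS_left]
    rfl
  have h2 : ‖z‖ ^ 2 ≤ ∑ p, ∑ i, ρ * (‖A.coefR p i g‖ * ‖A.coefS p i z‖) := by
    have h3 : ‖z‖ ^ 2 = ‖inner ℂ z z‖ := by
      rw [inner_self_eq_norm_sq_to_K]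
      simp
    rw [h3, h1]
    refine (norm_sum_le _ _).trans (Finset.sum_le_sum fun p _ => ?_)
    refine (norm_sum_le _ _).trans (Finset.sum_le_sum fun i _ => ?_)
    refine (norm_inner_le_norm _ _).trans ?_
    rw [← mul_assoc]
    gcongr
    exact (W p).le_of_opNorm_le (hW p) _
  have h4 : ∑ p, ∑ i, ‖A.coefR p i g‖ * ‖A.coefS p i z‖ ≤ ‖g‖ * ‖z‖ := by
    have h5 := Finset.sum_mul_sq_le_sq_mul_sq
      (Finset.univ : Finset (Σ p, Fin (Module.finrank ℂ (H p))))
      (fun k => ‖A.coefR k.1 k.2 g‖) (fun k => ‖A.coefS k.1 k.2 z‖)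
    simp only [Fintype.sum_sigma, sum_norm_sq_coefR, sum_norm_sq_coefS] at h5
    rw [← mul_pow] at h5
    exact abs_le_of_sq_le_sq' h5 (by positivity) |>.2
  simp only [← Finset.mul_sum] at h2
  by_contra hh
  push Not at hh
  have h6 : 0 < ‖z‖ := lt_of_le_of_lt (by positivity) hh
  nlinarith [mul_le_mul_of_nonneg_left h4 hρ]

end AdmissibleGraph

/-! ### Linear combinations and Gram matrices -/

/-- The linear map `c ↦ ∑ i, c i • u i`. -/
def linComb {X : Type*} [NormedAddCommGroup X] [InnerProductSpace ℂ X] {d : ℕ} (u : Fin d → X) :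
    EuclideanSpace ℂ (Fin d) →L[ℂ] X :=
  ∑ i, (EuclideanSpace.proj i : EuclideanSpace ℂ (Fin d) →L[ℂ] ℂ).smulRight (u i)

theorem linComb_apply {X : Type*} [NormedAddCommGroup X] [InnerProductSpace ℂ X] {d : ℕ}
    (u : Fin d → X) (c : EuclideanSpace ℂ (Fin d)) : linComb u c = ∑ i, c i • u i := by
  simp [linComb]

/-- The Gram matrix of `u` represents the quadratic form `c ↦ ‖∑ i, c i • u i‖²`. -/
theorem inner_linComb_self {X : Type*} [NormedAddCommGroup X] [InnerProductSpace ℂ X] {d : ℕ}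
    (u : Fin d → X) (c : EuclideanSpace ℂ (Fin d)) :
    ∑ i, ∑ j, inner ℂ (u j) (u i) * (c i * star (c j)) = ((‖linComb u c‖ ^ 2 : ℝ) : ℂ) := by
  have h : inner ℂ (linComb u c) (linComb u c) = ((‖linComb u c‖ ^ 2 : ℝ) : ℂ) := by
    rw [inner_self_eq_norm_sq_to_K]
    push_cast
    rfl
  rw [← h, linComb_apply, sum_inner, Finset.sum_comm]
  refine Finset.sum_congr rfl fun j _ => ?_
  rw [inner_sum]
  refine Finset.sum_congr rfl fun i _ => ?_
  rw [inner_smul_left, inner_smul_right]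
  change _ = star (c j) * _
  ring

namespace AdmissibleGraph

variable {V : Type*} [Finite V] (A : AdmissibleGraph V) {H : A.Comp → Type*}
  [∀ p, NormedAddCommGroup (H p)] [∀ p, InnerProductSpace ℂ (H p)]
  [∀ p, FiniteDimensional ℂ (H p)]

/-! ### A destabilizing perturbation from approximately feasible vectors -/

/-- In every component the Gram matrix of the coefficients of `f` is at most the one of the
coefficients of `M f`, up to the error `δ ‖f‖²`. -/
def GramLE (M : A.EnhS H →L[ℂ] A.EnhR H) (δ : ℝ) (f : A.EnhS H) : Prop :=
  ∀ p (c : EuclideanSpace ℂ (Fin (Module.finrank ℂ (H p)))),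
    ‖linComb (fun i => A.coefS p i f) c‖ ^ 2 ≤
      ‖linComb (fun i => A.coefR p i (M f)) c‖ ^ 2 + δ * ‖f‖ ^ 2 * ‖c‖ ^ 2

variable {A} in
theorem GramLE.smul {M : A.EnhS H →L[ℂ] A.EnhR H} {δ : ℝ} {f : A.EnhS H} (h : A.GramLE M δ f)
    (t : ℂ) : A.GramLE M δ (t • f) := by
  intro p c
  have h1 : linComb (fun i => A.coefS p i (t • f)) c =
      t • linComb (fun i => A.coefS p i f) c := by
    simp only [linComb_apply, map_smul, Finset.smul_sum, smul_comm t]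
  have h2 : linComb (fun i => A.coefR p i (M (t • f))) c =
      t • linComb (fun i => A.coefR p i (M f)) c := by
    simp only [linComb_apply, map_smul, Finset.smul_sum, smul_comm t]
  rw [h1, h2, norm_smul, norm_smul, norm_smul]
  have := mul_le_mul_of_nonneg_left (h p c) (sq_nonneg ‖t‖)
  linarith

theorem exists_contraction_of_gramLE {M : A.EnhS H →L[ℂ] A.EnhR H} {ε : ℝ} (hε : 0 < ε)
    {f : A.EnhS H} (hf : ‖f‖ = 1) (h : A.GramLE M (ε ^ 2) f) :
    ∃ W : ∀ p, A.TildeR p →L[ℂ] A.TildeS p, (∀ p, ‖W p‖ ≤ 1) ∧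
      ∀ p i, ‖W p (A.coefR p i (M f)) - A.coefS p i f‖ ≤ ε := by
  have key : ∀ p, ∃ W : A.TildeR p →L[ℂ] A.TildeS p, ‖W‖ ≤ 1 ∧
      ∀ i, ‖W (A.coefR p i (M f)) - A.coefS p i f‖ ≤ ε := by
    intro p
    obtain ⟨W, hW, hWc⟩ := exists_contraction_of_norm_sq_le
      (linComb fun i => A.coefR p i (M f)) (linComb fun i => A.coefS p i f) hε fun c => by
        have := h p c
        rwa [hf, one_pow, mul_one] at this
    refine ⟨W, hW, fun i => ?_⟩
    have := hWc (EuclideanSpace.single i 1)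
    simpa [linComb_apply, Pi.single_apply, ite_smul] using this
  choose W hW using key
  exact ⟨W, fun p => (hW p).1, fun p => (hW p).2⟩

theorem exists_forall_norm_star_pow_le {ε : ℝ} (hε : 0 < ε) (f : A.EnhS H) (g : A.EnhR H) :
    ∃ L : ℕ, ∀ p i, ‖(star (A.shiftTildeS p) ^ L) (A.coefS p i f)‖ ≤ ε ∧
      ‖(star (A.shiftTildeR p) ^ L) (A.coefR p i g)‖ ≤ ε := by
  have h : ∀ᶠ L in Filter.atTop, ∀ p i,
      ‖(star (A.shiftTildeS p) ^ L) (A.coefS p i f)‖ ≤ ε ∧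
      ‖(star (A.shiftTildeR p) ^ L) (A.coefR p i g)‖ ≤ ε := by
    simp only [Filter.eventually_all, Filter.eventually_and]
    intro p i
    have h1 := tendsto_zero_iff_norm_tendsto_zero.mp
      (A.tendsto_star_shiftTildeS_pow p (A.coefS p i f))
    have h2 := tendsto_zero_iff_norm_tendsto_zero.mp
      (A.tendsto_star_shiftTildeR_pow p (A.coefR p i g))
    exact ⟨h1.eventually_le_const hε, h2.eventually_le_const hε⟩
  exact h.exists

/-- If no structured contraction destabilizes, then the domination of Gram matrices fails by a
uniform margin: otherwise approximate solutions with errors `1 / (n + 1)`, moved to disjoint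
windows, would produce one structured contraction `Δ` such that `1 - Δ M` is not bounded below. -/
theorem exists_pos_forall_gramLE {M : A.EnhS H →L[ℂ] A.EnhR H} (hM : A.ShiftInvariant M)
    (h1 : ∀ W : ∀ p, A.TildeR p →L[ℂ] A.TildeS p, (∀ p, ‖W p‖ ≤ 1) →
      IsUnit (1 - A.blockDiag W ∘L M)) :
    ∃ δ : ℝ, 0 < δ ∧ ∀ f, A.GramLE M δ f → f = 0 := by
  by_contra hcon
  push Not at hcon
  set ε : ℕ → ℝ := fun n => 1 / ((n : ℝ) + 1) with hε
  have hεpos : ∀ n, 0 < ε n := fun n => Nat.one_div_pos_of_nat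
  have hex : ∀ n, ∃ f : A.EnhS H, ‖f‖ = 1 ∧ A.GramLE M (ε n ^ 2) f := by
    intro n
    obtain ⟨f, hf, hf0⟩ := hcon (ε n ^ 2) (pow_pos (hεpos n) 2)
    refine ⟨((‖f‖⁻¹ : ℝ) : ℂ) • f, ?_, hf.smul _⟩
    rw [norm_smul, Complex.norm_real, norm_inv, norm_norm,
      inv_mul_cancel₀ (norm_ne_zero_iff.mpr hf0)]
  choose f hf hgram using hex
  choose W hW hWf using fun n => A.exists_contraction_of_gramLE (hεpos n) (hf n) (hgram n)
  choose L hL using fun n => A.exists_forall_norm_star_pow_le (hεpos n) (f n) (M (f n))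
  choose T hT hTW using fun p => exists_contraction_of_windows (A.star_shiftTildeR_mul p)
    (A.star_shiftTildeS_mul p) (fun n => W n p) (fun n => hW n p) L
  -- `1 - Δ M` is invertible for the operator `Δ` with these blocks, but it maps the unit vectors
  -- `V^a (f n)`, `a = windowStart L n`, to vectors of norm at most `4 C / (n + 1)`.
  obtain ⟨u, hu⟩ := h1 T hT
  set C : ℝ := ∑ p, ∑ i, ‖A.tensorVecS p (stdOrthonormalBasis ℂ (H p) i)‖ with hC
  have hC0 : 0 ≤ C := by positivity
  have hbound : ∀ n, ‖(1 - A.blockDiag T ∘L M) ((A.shiftS H ^ windowStart L n) (f n))‖ ≤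
      C * (4 * ε n) := by
    intro n
    rw [sub_apply, one_apply_eq_self, ContinuousLinearMap.comp_apply, A.map_shiftS_pow hM,
      norm_sub_rev]
    conv_lhs => rw [← A.sum_tensorVecS_coefS ((A.shiftS H ^ windowStart L n) (f n)),
      blockDiag_apply]
    simp only [← Finset.sum_sub_distrib, ← map_sub, hC, Finset.sum_mul]
    refine (norm_sum_le _ _).trans (Finset.sum_le_sum fun p _ => ?_)
    refine (norm_sum_le _ _).trans (Finset.sum_le_sum fun i _ => ?_)
    refine (ContinuousLinearMap.le_opNorm _ _).trans ?_
    gcongr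
    rw [coefR, coefS, contractR_shiftR_pow, contractS_shiftS_pow]
    exact norm_block_sub_le (A.star_shiftTildeR_mul p) (A.star_shiftTildeS_mul p) (hW n p) (hT p)
      (hTW p n _) (hL n p i).2 (hL n p i).1 (hWf n p i)
  have hlow : ∀ n, 1 ≤ ‖(↑u⁻¹ : A.EnhS H →L[ℂ] A.EnhS H)‖ * (C * (4 * ε n)) := by
    intro n
    set x := (A.shiftS H ^ windowStart L n) (f n) with hx
    have hx1 : ‖x‖ = 1 := by rw [hx, norm_shiftS_pow, hf]
    have h2 : (↑u⁻¹ : A.EnhS H →L[ℂ] A.EnhS H) ((u : A.EnhS H →L[ℂ] A.EnhS H) x) = x := by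
      rw [← mul_apply_eq_comp, Units.inv_mul, one_apply_eq_self]
    rw [← hx1]
    conv_lhs => rw [← h2]
    refine (ContinuousLinearMap.le_opNorm _ _).trans ?_
    gcongr
    rw [hu]
    exact hbound n
  have hlim : Filter.Tendsto (fun n => ‖(↑u⁻¹ : A.EnhS H →L[ℂ] A.EnhS H)‖ * (C * (4 * ε n)))
      Filter.atTop (nhds (‖(↑u⁻¹ : A.EnhS H →L[ℂ] A.EnhS H)‖ * (C * (4 * 0)))) :=
    ((tendsto_one_div_add_atTop_nhds_zero_nat.const_mul 4).const_mul C).const_mul _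
  have := ge_of_tendsto' hlim hlow
  norm_num at this

end AdmissibleGraph

/-! ### Coercive operators and translates -/

theorem isStrictlyPositive_of_le_re_inner {K : Type*} [NormedAddCommGroup K]
    [InnerProductSpace ℂ K] [CompleteSpace K] {T : K →L[ℂ] K} (hT : IsSelfAdjoint T) {c : ℝ}
    (hc : 0 < c) (h : ∀ x, c * ‖x‖ ^ 2 ≤ (inner ℂ x (T x)).re) : IsStrictlyPositive T := by
  refine IsStrictlyPositive.of_le (a := c • (1 : K →L[ℂ] K))
    (IsStrictlyPositive.smul hc isStrictlyPositive_one) ?_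
  rw [ContinuousLinearMap.le_def, ContinuousLinearMap.isPositive_def']
  refine ⟨hT.sub ((IsSelfAdjoint.all c).smul (IsSelfAdjoint.one _)), fun x => ?_⟩
  rw [ContinuousLinearMap.reApplyInnerSelf_apply, inner_re_symm]
  have h1 : inner ℂ x ((T - c • (1 : K →L[ℂ] K)) x) =
      inner ℂ x (T x) - ((c * ‖x‖ ^ 2 : ℝ) : ℂ) := by
    rw [sub_apply, inner_sub_right]
    simp [inner_smul_right_eq_smul, inner_self_eq_norm_sq_to_K]
  rw [h1]
  have := h x
  simp only [RCLike.re_to_complex, Complex.sub_re, Complex.ofReal_re]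
  linarith

/-- Large translates of a vector are asymptotically orthogonal to every fixed vector. -/
theorem tendsto_inner_add_pow {K : Type*} [NormedAddCommGroup K] [InnerProductSpace ℂ K]
    [CompleteSpace K] {V : K →L[ℂ] K} (hV : star V * V = 1)
    (hV0 : ∀ x, Filter.Tendsto (fun n => (star V ^ n) x) Filter.atTop (nhds 0)) (x y x' y' : K) :
    Filter.Tendsto (fun n => inner ℂ (x + (V ^ n) x') (y + (V ^ n) y')) Filter.atTop
      (nhds (inner ℂ x y + inner ℂ x' y')) := by
  have h1 : ∀ n, inner ℂ (x + (V ^ n) x') (y + (V ^ n) y') =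
      inner ℂ x y + inner ℂ x' y' + inner ℂ ((star V ^ n) x) y' +
        inner ℂ x' ((star V ^ n) y) := by
    intro n
    have e1 : inner ℂ ((star V ^ n) x) y' = inner ℂ x ((V ^ n) y') := by
      rw [← star_pow, inner_star_left]
    have e2 : inner ℂ x' ((star V ^ n) y) = inner ℂ ((V ^ n) x') y := by
      rw [← star_pow, ← inner_star_left, star_star]
    have e3 : inner ℂ ((V ^ n) x') ((V ^ n) y') = inner ℂ x' y' := by
      rw [← inner_star_left, ← mul_apply_eq_comp, star_pow, star_pow_mul_pow hV, one_apply_eq_self]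
    rw [inner_add_left, inner_add_right, inner_add_right, e1, e2, e3]
    ring
  simp only [h1]
  have h2 := ((hV0 x).inner (𝕜 := ℂ) (tendsto_const_nhds (x := y')))
  have h3 := ((tendsto_const_nhds (x := x')).inner (𝕜 := ℂ) (hV0 y))
  simpa using (tendsto_const_nhds.add h2).add h3

namespace AdmissibleGraph

variable {V : Type*} (A : AdmissibleGraph V) (H : A.Comp → Type*)
  [∀ p, NormedAddCommGroup (H p)] [∀ p, InnerProductSpace ℂ (H p)]

/-! ### Gram matrices and the separating functional -/

/-- Families of square matrices, one for each component, of the size `dim H p`. -/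
abbrev MatFam : Type _ :=
  ∀ p : A.Comp, Fin (Module.finrank ℂ (H p)) → Fin (Module.finrank ℂ (H p)) → ℂ

variable {H}

/-- The sesquilinear form of the matrix `X p`, evaluated on the diagonal. -/
def quad (X : A.MatFam H) (p : A.Comp) (c : EuclideanSpace ℂ (Fin (Module.finrank ℂ (H p)))) :
    ℂ :=
  ∑ i, ∑ j, X p i j * (c i * star (c j))

variable (H) in
/-- The family of the identity matrices. -/
def oneFam : A.MatFam H := fun _ i j => if i = j then 1 else 0

theorem quad_add (X Y : A.MatFam H) (p c) : A.quad (X + Y) p c = A.quad X p c + A.quad Y p c := by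
  simp [quad, add_mul, Finset.sum_add_distrib]

theorem quad_smul (a : ℂ) (X : A.MatFam H) (p c) : A.quad (a • X) p c = a * A.quad X p c := by
  simp [quad, mul_assoc, Finset.mul_sum]

theorem quad_oneFam (p c) : A.quad (A.oneFam H) p c = ((‖c‖ ^ 2 : ℝ) : ℂ) := by
  simp only [quad, oneFam, ite_mul, one_mul, zero_mul, Finset.sum_ite_eq, Finset.mem_univ, if_true,
    EuclideanSpace.norm_sq_eq]
  push_cast
  exact Finset.sum_congr rfl fun i _ => RCLike.mul_conj (c i)

variable (H) in
/-- The families of matrices with uniformly positive definite real part. -/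
def accretive : Set (A.MatFam H) :=
  {X | ∃ r : ℝ, 0 < r ∧ ∀ p c, r * ‖c‖ ^ 2 ≤ (A.quad X p c).re}

theorem convex_accretive : Convex ℝ (A.accretive H) := by
  rintro X ⟨r, hr, hX⟩ Y ⟨s, hs, hY⟩ a b ha hb hab
  refine ⟨a * r + b * s, ?_, fun p c => ?_⟩
  · rcases ha.eq_or_lt with rfl | ha'
    · have : b = 1 := by linarith
      subst this
      linarith
    · nlinarith [mul_pos ha' hr, mul_nonneg hb hs.le]
  · have e : a • X + b • Y = (a : ℂ) • X + (b : ℂ) • Y := rfl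
    rw [e, quad_add, quad_smul, quad_smul, Complex.add_re, Complex.re_ofReal_mul,
      Complex.re_ofReal_mul]
    nlinarith [mul_le_mul_of_nonneg_left (hX p c) ha, mul_le_mul_of_nonneg_left (hY p c) hb]

theorem oneFam_mem_accretive : A.oneFam H ∈ A.accretive H :=
  ⟨1, one_pos, fun p c => by rw [quad_oneFam, Complex.ofReal_re, one_mul]⟩

variable [Finite V]

/-- The sum of the traces of the matrices of a family. -/
def tr (X : A.MatFam H) : ℂ := ∑ p, ∑ i, X p i i

theorem norm_quad_le (X : A.MatFam H) (p c) :
    ‖A.quad X p c‖ ≤ ‖X‖ * (∑ q, (Module.finrank ℂ (H q) : ℝ)) * ‖c‖ ^ 2 := by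
  have h1 : ‖A.quad X p c‖ ≤ ‖X‖ * (∑ i, ‖c i‖) ^ 2 := by
    rw [sq, Finset.sum_mul_sum, Finset.mul_sum]
    refine (norm_sum_le _ _).trans (Finset.sum_le_sum fun i _ => ?_)
    rw [Finset.mul_sum]
    refine (norm_sum_le _ _).trans (Finset.sum_le_sum fun j _ => ?_)
    rw [norm_mul, norm_mul, norm_star]
    gcongr
    exact (norm_le_pi_norm _ j).trans ((norm_le_pi_norm _ i).trans (norm_le_pi_norm X p))
  have h2 : (∑ i, ‖c i‖) ^ 2 ≤ Module.finrank ℂ (H p) * ‖c‖ ^ 2 := by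
    have := sq_sum_le_card_mul_sum_sq (s := Finset.univ) (f := fun i => ‖c i‖)
    rwa [Finset.card_fin, ← EuclideanSpace.norm_sq_eq] at this
  have h3 : (Module.finrank ℂ (H p) : ℝ) ≤ ∑ q, (Module.finrank ℂ (H q) : ℝ) :=
    Finset.single_le_sum (f := fun q => (Module.finrank ℂ (H q) : ℝ))
      (fun q _ => Nat.cast_nonneg _) (Finset.mem_univ p)
  calc ‖A.quad X p c‖ ≤ ‖X‖ * (∑ i, ‖c i‖) ^ 2 := h1
    _ ≤ ‖X‖ * ((∑ q, (Module.finrank ℂ (H q) : ℝ)) * ‖c‖ ^ 2) := by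
      gcongr
      exact h2.trans (by gcongr)
    _ = _ := by ring

theorem isOpen_accretive : IsOpen (A.accretive H) := by
  rw [Metric.isOpen_iff]
  rintro X ⟨r, hr, hX⟩
  set D : ℝ := ∑ q, (Module.finrank ℂ (H q) : ℝ) with hD
  have hD0 : 0 ≤ D := by positivity
  refine ⟨r / (2 * (D + 1)), by positivity, fun Y hY => ⟨r / 2, by positivity, fun p c => ?_⟩⟩
  rw [mem_ball_iff_norm] at hY
  have e : A.quad Y p c = A.quad X p c + A.quad (Y - X) p c := by
    rw [← quad_add, add_sub_cancel]
  have h1 := A.norm_quad_le (Y - X) p c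
  rw [← hD] at h1
  have h2 : ‖Y - X‖ * D ≤ r / 2 := by
    rw [lt_div_iff₀ (by positivity)] at hY
    nlinarith [norm_nonneg (Y - X)]
  have h3 := (abs_le.mp (Complex.abs_re_le_norm (A.quad (Y - X) p c))).1
  rw [e, Complex.add_re]
  nlinarith [hX p c, mul_le_mul_of_nonneg_right h2 (sq_nonneg ‖c‖)]

variable [∀ p, FiniteDimensional ℂ (H p)]

/-- The Gram matrices of the coefficients of a vector of `H_S`. The order of the indices makes
`quad (gramS f) p c` the squared norm of `∑ i, c i • coefS p i f`. -/
def gramS (f : A.EnhS H) : A.MatFam H := fun p i j => inner ℂ (A.coefS p j f) (A.coefS p i f)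

/-- The Gram matrices of the coefficients of a vector of `H_R`. -/
def gramR (g : A.EnhR H) : A.MatFam H := fun p i j => inner ℂ (A.coefR p j g) (A.coefR p i g)

theorem quad_gramS (f : A.EnhS H) (p c) :
    A.quad (A.gramS f) p c = ((‖linComb (fun i => A.coefS p i f) c‖ ^ 2 : ℝ) : ℂ) :=
  inner_linComb_self _ c

theorem quad_gramR (g : A.EnhR H) (p c) :
    A.quad (A.gramR g) p c = ((‖linComb (fun i => A.coefR p i g) c‖ ^ 2 : ℝ) : ℂ) :=
  inner_linComb_self _ c

theorem tr_gramS (f : A.EnhS H) : A.tr (A.gramS f) = ((‖f‖ ^ 2 : ℝ) : ℂ) := by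
  refine (A.sum_inner_coefS f f).trans ?_
  rw [inner_self_eq_norm_sq_to_K]
  push_cast
  rfl

/-- The Gram matrices of `M f` minus those of `f`, shifted by `δ ‖f‖²`. -/
def defect (M : A.EnhS H →L[ℂ] A.EnhR H) (δ : ℝ) (f : A.EnhS H) : A.MatFam H :=
  A.gramR (M f) - A.gramS f + ((δ : ℂ) * A.tr (A.gramS f)) • A.oneFam H

theorem defect_smul (M : A.EnhS H →L[ℂ] A.EnhR H) (δ t : ℝ) (f : A.EnhS H) :
    A.defect M δ ((t : ℂ) • f) = (t ^ 2) • A.defect M δ f := by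
  have h1 : A.gramS ((t : ℂ) • f) = (t ^ 2) • A.gramS f := by
    funext p i j
    simp only [gramS, map_smul, inner_smul_left, inner_smul_right, Pi.smul_apply,
      Complex.real_smul, Complex.conj_ofReal]
    push_cast
    ring
  have h2 : A.gramR (M ((t : ℂ) • f)) = (t ^ 2) • A.gramR (M f) := by
    funext p i j
    simp only [gramR, map_smul, inner_smul_left, inner_smul_right, Pi.smul_apply,
      Complex.real_smul, Complex.conj_ofReal]
    push_cast
    ring
  have h3 : A.tr ((t ^ 2) • A.gramS f) = (t : ℂ) ^ 2 * A.tr (A.gramS f) := by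
    simp [tr, Finset.mul_sum]
  rw [defect, defect, h1, h2, h3]
  funext p i j
  simp
  ring

/-- The defect is asymptotically additive along translates; this is where shift-invariance makes
the separation argument work. -/
theorem tendsto_defect {M : A.EnhS H →L[ℂ] A.EnhR H} (hM : A.ShiftInvariant M) (δ : ℝ)
    (f g : A.EnhS H) :
    Filter.Tendsto (fun n => A.defect M δ (f + (A.shiftS H ^ n) g)) Filter.atTop
      (nhds (A.defect M δ f + A.defect M δ g)) := by
  have hS : Filter.Tendsto (fun n => A.gramS (f + (A.shiftS H ^ n) g)) Filter.atTop
      (nhds (A.gramS f + A.gramS g)) := by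
    refine tendsto_pi_nhds.mpr fun p => tendsto_pi_nhds.mpr fun i => tendsto_pi_nhds.mpr fun j => ?_
    simp only [gramS, coefS, map_add, contractS_shiftS_pow]
    exact tendsto_inner_add_pow (A.star_shiftTildeS_mul p)
      (A.tendsto_star_shiftTildeS_pow p) _ _ _ _
  have hR : Filter.Tendsto (fun n => A.gramR (M (f + (A.shiftS H ^ n) g))) Filter.atTop
      (nhds (A.gramR (M f) + A.gramR (M g))) := by
    refine tendsto_pi_nhds.mpr fun p => tendsto_pi_nhds.mpr fun i => tendsto_pi_nhds.mpr fun j => ?_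
    simp only [gramR, coefR, map_add, A.map_shiftS_pow hM, contractR_shiftR_pow]
    exact tendsto_inner_add_pow (A.star_shiftTildeR_mul p)
      (A.tendsto_star_shiftTildeR_pow p) _ _ _ _
  have htr : Continuous (A.tr (H := H)) := by
    unfold tr
    fun_prop
  have h := (hR.sub hS).add
    ((((htr.tendsto _).comp hS).const_mul (δ : ℂ)).smul_const (A.oneFam H))
  have e : A.defect M δ f + A.defect M δ g = A.gramR (M f) + A.gramR (M g) -
      (A.gramS f + A.gramS g) + ((δ : ℂ) * A.tr (A.gramS f + A.gramS g)) • A.oneFam H := by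
    have ht : A.tr (A.gramS f + A.gramS g) = A.tr (A.gramS f) + A.tr (A.gramS g) := by
      simp [tr, Finset.sum_add_distrib]
    rw [defect, defect, ht, mul_add, add_smul]
    abel
  rw [e]
  exact h

theorem convex_closure_range_defect {M : A.EnhS H →L[ℂ] A.EnhR H} (hM : A.ShiftInvariant M)
    (δ : ℝ) : Convex ℝ (closure (Set.range (A.defect M δ))) := by
  have hadd : ∀ x ∈ closure (Set.range (A.defect M δ)), ∀ y ∈ closure (Set.range (A.defect M δ)),
      x + y ∈ closure (Set.range (A.defect M δ)) := by
    intro x hx y hy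
    have := map_mem_closure₂ (u := closure (Set.range (A.defect M δ))) continuous_add hx hy (by
      rintro _ ⟨f, rfl⟩ _ ⟨g, rfl⟩
      exact mem_closure_of_tendsto (A.tendsto_defect hM δ f g)
        (Filter.Eventually.of_forall fun n => Set.mem_range_self _))
    rwa [closure_closure] at this
  have hsmul : ∀ a : ℝ, 0 ≤ a → ∀ x ∈ closure (Set.range (A.defect M δ)),
      a • x ∈ closure (Set.range (A.defect M δ)) := by
    intro a ha x hx
    refine map_mem_closure (continuous_const_smul a) hx ?_
    rintro _ ⟨f, rfl⟩
    exact ⟨((√a : ℝ) : ℂ) • f, by rw [defect_smul, Real.sq_sqrt ha]⟩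
  intro x hx y hy a b ha hb _
  exact hadd _ (hsmul a ha x hx) _ (hsmul b hb y hy)

/-- The functional of the Hahn–Banach theorem; it is nonpositive on the defects since these form a
cone. Without a nonzero space `H p` the two separated sets would coincide. -/
theorem exists_separating_functional {M : A.EnhS H →L[ℂ] A.EnhR H} (hM : A.ShiftInvariant M)
    {δ : ℝ} (hδ : ∀ f, A.GramLE M δ f → f = 0) (hne : ∃ p, Nontrivial (H p)) :
    ∃ Λ : A.MatFam H →ₗ[ℂ] ℂ, (∀ X ∈ A.accretive H, 0 < (Λ X).re) ∧
      ∀ f, (Λ (A.defect M δ f)).re ≤ 0 := by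
  have hdisj : Disjoint (A.accretive H) (closure (Set.range (A.defect M δ))) := by
    rw [Set.disjoint_left]
    intro X hX hXc
    obtain ⟨_, ⟨r, hr, hY⟩, f, rfl⟩ := mem_closure_iff.mp hXc _ A.isOpen_accretive hX
    have hquad : ∀ p c, (A.quad (A.defect M δ f) p c).re =
        ‖linComb (fun i => A.coefR p i (M f)) c‖ ^ 2 - ‖linComb (fun i => A.coefS p i f) c‖ ^ 2 +
          δ * ‖f‖ ^ 2 * ‖c‖ ^ 2 := by
      intro p c
      have e : A.defect M δ f = A.gramR (M f) + (-1 : ℂ) • A.gramS f +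
          ((δ : ℂ) * A.tr (A.gramS f)) • A.oneFam H := by
        rw [defect, neg_one_smul, ← sub_eq_add_neg]
      rw [e, quad_add, quad_add, quad_smul, quad_smul, quad_gramR, quad_gramS, quad_oneFam,
        tr_gramS, neg_one_mul, ← Complex.ofReal_neg, ← Complex.ofReal_mul, ← Complex.ofReal_mul,
        ← Complex.ofReal_add, ← Complex.ofReal_add, Complex.ofReal_re]
      ring
    have hf : f = 0 := hδ f fun p c => by
      have h1 := hY p c
      rw [hquad] at h1
      nlinarith [mul_nonneg hr.le (sq_nonneg ‖c‖)]
    obtain ⟨p, hp⟩ := hne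
    have hd : 0 < Module.finrank ℂ (H p) := Module.finrank_pos
    have h1 := hY p (EuclideanSpace.single ⟨0, hd⟩ 1)
    rw [hquad, hf] at h1
    simp [linComb_apply] at h1
    linarith
  obtain ⟨φ, u, hφ1, hφ2⟩ := RCLike.geometric_hahn_banach_open (𝕜 := ℂ)
    (E := A.MatFam H) A.convex_accretive A.isOpen_accretive
    (A.convex_closure_range_defect hM δ) hdisj
  have hφ3 : ∀ f, u ≤ (φ (A.defect M δ f)).re := fun f =>
    hφ2 _ (subset_closure (Set.mem_range_self f))
  have hu : u ≤ 0 := by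
    have h := hφ3 (((0 : ℝ) : ℂ) • (0 : A.EnhS H))
    rw [defect_smul] at h
    simpa using h
  refine ⟨-(φ : A.MatFam H →ₗ[ℂ] ℂ), fun X hX => ?_, fun f => ?_⟩
  · have h : (φ X).re < u := hφ1 X hX
    change 0 < (-(φ X)).re
    rw [Complex.neg_re]
    linarith
  · change (-(φ (A.defect M δ f))).re ≤ 0
    rw [Complex.neg_re]
    by_contra hh
    push Not at hh
    -- A negative value `a` at `f` would give the value `u - 1` at a multiple of `f`.
    set a := (φ (A.defect M δ f)).re with ha
    have ha0 : a < 0 := by linarith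
    have h := hφ3 (((√((u - 1) / a) : ℝ) : ℂ) • f)
    rw [defect_smul, Real.sq_sqrt (div_nonneg_of_nonpos (by linarith) ha0.le)] at h
    have e : (φ (((u - 1) / a) • A.defect M δ f)).re = u - 1 := by
      have : φ (((u - 1) / a) • A.defect M δ f) = (((u - 1) / a : ℝ) : ℂ) * φ (A.defect M δ f) :=
        φ.map_smul (((u - 1) / a : ℝ) : ℂ) (A.defect M δ f)
      rw [this, Complex.re_ofReal_mul, ← ha, div_mul_cancel₀ _ ha0.ne]
    linarith

end AdmissibleGraph

namespace AdmissibleGraph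

variable {V : Type*} (A : AdmissibleGraph V) {H : A.Comp → Type*}
  [∀ p, NormedAddCommGroup (H p)] [∀ p, InnerProductSpace ℂ (H p)]

/-! ### From the separating functional to the multipliers -/

section Positivity

variable {A}

theorem re_nonneg_of_re_quad_nonneg {Λ : A.MatFam H →ₗ[ℂ] ℂ}
    (hΛ : ∀ X ∈ A.accretive H, 0 < (Λ X).re) {X : A.MatFam H}
    (hX : ∀ p c, 0 ≤ (A.quad X p c).re) : 0 ≤ (Λ X).re := by
  have h1 : ∀ η : ℝ, 0 < η → 0 < (Λ X).re + η * (Λ (A.oneFam H)).re := by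
    intro η hη
    have h := hΛ (X + (η : ℂ) • A.oneFam H) ⟨η, hη, fun p c => by
      rw [quad_add, quad_smul, quad_oneFam, Complex.add_re, Complex.re_ofReal_mul,
        Complex.ofReal_re]
      linarith [hX p c]⟩
    rwa [map_add, map_smul, smul_eq_mul, Complex.add_re, Complex.re_ofReal_mul] at h
  have hpos := hΛ _ A.oneFam_mem_accretive
  by_contra hh
  push Not at hh
  have h2 := h1 (-(Λ X).re / (Λ (A.oneFam H)).re) (div_pos (by linarith) hpos)
  rw [div_mul_cancel₀ _ hpos.ne'] at h2
  linarith

/-- A functional that is positive on the accretive families does not see skew-adjoint families. -/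
theorem re_eq_zero_of_re_quad_eq_zero {Λ : A.MatFam H →ₗ[ℂ] ℂ}
    (hΛ : ∀ X ∈ A.accretive H, 0 < (Λ X).re) {X : A.MatFam H}
    (hX : ∀ p c, (A.quad X p c).re = 0) : (Λ X).re = 0 := by
  have h1 := re_nonneg_of_re_quad_nonneg hΛ fun p c => (hX p c).ge
  have h2 := re_nonneg_of_re_quad_nonneg hΛ (X := (-1 : ℂ) • X) fun p c => by
    rw [quad_smul, neg_one_mul, Complex.neg_re, hX, neg_zero]
  rw [map_smul, smul_eq_mul, neg_one_mul, Complex.neg_re] at h2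
  linarith

end Positivity

/-- The entry of a linear functional on families of matrices at the matrix unit `(i, j)` in the
component `p`. -/
def entry (Λ : A.MatFam H →ₗ[ℂ] ℂ) (p : A.Comp) (i j : Fin (Module.finrank ℂ (H p))) : ℂ :=
  letI := Classical.decEq A.Comp
  Λ (Pi.single p (Pi.single i (Pi.single j 1)))

theorem apply_eq_sum_entry [Finite V] (Λ : A.MatFam H →ₗ[ℂ] ℂ) (X : A.MatFam H) :
    Λ X = ∑ p, ∑ i, ∑ j, X p i j * A.entry Λ p i j := by
  classical
  have h : X = ∑ p, ∑ i, ∑ j,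
      X p i j • (Pi.single p (Pi.single i (Pi.single j 1)) : A.MatFam H) := by
    funext q k l
    simp only [Finset.sum_apply, Pi.smul_apply]
    rw [Finset.sum_eq_single q]
    · simp [Pi.single_apply, ite_apply]
    · intro p _ hp
      simp [Pi.single_eq_of_ne hp.symm]
    · exact fun h => absurd (Finset.mem_univ q) h
  conv_lhs => rw [h]
  simp only [map_sum, map_smul, smul_eq_mul, entry]

section

variable {A}

theorem diagS_idTensor_add_smul [Finite V] (Γ : ∀ p, H p →L[ℂ] H p) (κ : ℝ) :
    A.diagS (fun p => idTensor (Γ p + (κ : ℂ) • (1 : H p →L[ℂ] H p))) =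
      A.diagS (fun p => idTensor (Γ p)) + (κ : ℂ) • (1 : A.EnhS H →L[ℂ] A.EnhS H) := by
  change coordMap _ = coordMap _ + _
  ext f s n
  simp [coordMap_apply]
  rfl

theorem diagR_idTensor_add_smul [Finite V] (Γ : ∀ p, H p →L[ℂ] H p) (κ : ℝ) :
    A.diagR (fun p => idTensor (Γ p + (κ : ℂ) • (1 : H p →L[ℂ] H p))) =
      A.diagR (fun p => idTensor (Γ p)) + (κ : ℂ) • (1 : A.EnhR H →L[ℂ] A.EnhR H) := by
  change coordMap _ = coordMap _ + _
  ext f s n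
  simp [coordMap_apply]
  rfl

end

variable [∀ p, FiniteDimensional ℂ (H p)]

/-- The operators on the spaces `H p` that represent a linear functional on families of
matrices. -/
def multiplier (Λ : A.MatFam H →ₗ[ℂ] ℂ) (p : A.Comp) : H p →L[ℂ] H p :=
  ∑ i, ∑ j, A.entry Λ p i j • InnerProductSpace.rankOne ℂ (stdOrthonormalBasis ℂ (H p) j)
    (stdOrthonormalBasis ℂ (H p) i)

/-- The family whose only nonzero matrix is the rank one matrix of the coordinates of `a`. -/
def rankOneFam (p : A.Comp) (a : H p) : A.MatFam H :=
  letI := Classical.decEq A.Comp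
  Pi.single p fun i j => inner ℂ (stdOrthonormalBasis ℂ (H p) i) a *
    inner ℂ a (stdOrthonormalBasis ℂ (H p) j)

theorem quad_rankOneFam (p : A.Comp) (a : H p) (q c) :
    ∃ r : ℝ, 0 ≤ r ∧ A.quad (A.rankOneFam p a) q c = r := by
  let _ := Classical.decEq A.Comp
  by_cases hq : q = p
  · subst hq
    refine ⟨‖∑ i, inner ℂ (stdOrthonormalBasis ℂ (H q) i) a * c i‖ ^ 2, by positivity, ?_⟩
    push_cast
    rw [← Complex.mul_conj', map_sum, Finset.sum_mul_sum]
    simp only [quad, rankOneFam, Pi.single_eq_same]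
    refine Finset.sum_congr rfl fun i _ => Finset.sum_congr rfl fun j _ => ?_
    rw [map_mul, inner_conj_symm]
    change _ = _ * (_ * star (c j))
    ring
  · exact ⟨0, le_rfl, by simp [quad, rankOneFam, Pi.single_eq_of_ne hq]⟩

theorem multiplier_basis (Λ : A.MatFam H →ₗ[ℂ] ℂ) (p : A.Comp)
    (i : Fin (Module.finrank ℂ (H p))) :
    A.multiplier Λ p (stdOrthonormalBasis ℂ (H p) i) =
      ∑ j, A.entry Λ p i j • stdOrthonormalBasis ℂ (H p) j := by
  simp only [multiplier, sum_apply, smul_apply, InnerProductSpace.rankOne_apply]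
  rw [Finset.sum_eq_single i]
  · simp
  · intro k _ hk
    simp [(stdOrthonormalBasis ℂ (H p)).orthonormal.inner_eq_zero hk]
  · exact fun h => absurd (Finset.mem_univ i) h

variable [Finite V]

theorem inner_multiplier (Λ : A.MatFam H →ₗ[ℂ] ℂ) (p : A.Comp) (a : H p) :
    inner ℂ a (A.multiplier Λ p a) = Λ (A.rankOneFam p a) := by
  let _ := Classical.decEq A.Comp
  rw [apply_eq_sum_entry, Finset.sum_eq_single p]
  · simp only [multiplier, sum_apply, inner_sum, rankOneFam, Pi.single_eq_same, smul_apply,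
      InnerProductSpace.rankOne_apply, inner_smul_right]
    exact Finset.sum_congr rfl fun i _ => Finset.sum_congr rfl fun j _ => by ring
  · intro q _ hq
    simp [rankOneFam, Pi.single_eq_of_ne hq]
  · exact fun h => absurd (Finset.mem_univ p) h

variable {A}

/-- The quadratic form of a multiplier is real and nonnegative: a rank one matrix is positive
semidefinite, and `i` times it is skew-adjoint. -/
theorem inner_multiplier_eq_re {Λ : A.MatFam H →ₗ[ℂ] ℂ}
    (hΛ : ∀ X ∈ A.accretive H, 0 < (Λ X).re) (p : A.Comp) (a : H p) :
    ∃ r : ℝ, 0 ≤ r ∧ inner ℂ a (A.multiplier Λ p a) = r := by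
  refine ⟨(Λ (A.rankOneFam p a)).re, re_nonneg_of_re_quad_nonneg hΛ fun q c => ?_, ?_⟩
  · obtain ⟨r, hr, h⟩ := A.quad_rankOneFam p a q c
    rwa [h, Complex.ofReal_re]
  · rw [inner_multiplier]
    have h0 : (Λ (Complex.I • A.rankOneFam p a)).re = 0 :=
      re_eq_zero_of_re_quad_eq_zero hΛ fun q c => by
        obtain ⟨r, hr, h⟩ := A.quad_rankOneFam p a q c
        rw [quad_smul, h]
        simp
    rw [map_smul, smul_eq_mul, Complex.I_mul_re, neg_eq_zero] at h0
    exact Complex.ext rfl (by rw [h0, Complex.ofReal_im])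

theorem isPositive_multiplier {Λ : A.MatFam H →ₗ[ℂ] ℂ}
    (hΛ : ∀ X ∈ A.accretive H, 0 < (Λ X).re) (p : A.Comp) :
    (A.multiplier Λ p).IsPositive := by
  rw [ContinuousLinearMap.isPositive_iff_complex]
  intro a
  obtain ⟨r, hr, h⟩ := inner_multiplier_eq_re hΛ p a
  rw [← inner_conj_symm, h]
  simpa using hr

theorem re_inner_diagS_multiplier {Λ : A.MatFam H →ₗ[ℂ] ℂ}
    (hΛ : ∀ X ∈ A.accretive H, 0 < (Λ X).re) (f : A.EnhS H) :
    (inner ℂ f (A.diagS (fun p => idTensor (A.multiplier Λ p)) f)).re = (Λ (A.gramS f)).re := by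
  have h : inner ℂ f (A.diagS (fun p => idTensor (A.multiplier Λ p)) f) =
      star (Λ (A.gramS f)) := by
    rw [← A.sum_inner_coefS, apply_eq_sum_entry]
    simp only [star_sum]
    refine Finset.sum_congr rfl fun p _ => Finset.sum_congr rfl fun i _ => ?_
    have hs : star (A.multiplier Λ p) = A.multiplier Λ p :=
      (isPositive_multiplier hΛ p).isSelfAdjoint
    rw [coefS, contractS_diagS_idTensor, hs, A.multiplier_basis, contractS_sum, inner_sum]
    refine Finset.sum_congr rfl fun j _ => ?_
    rw [inner_smul_right, star_mul', mul_comm, gramS]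
    congr 1
    exact (inner_conj_symm _ _).symm
  rw [h]
  rfl

theorem re_inner_diagR_multiplier {Λ : A.MatFam H →ₗ[ℂ] ℂ}
    (hΛ : ∀ X ∈ A.accretive H, 0 < (Λ X).re) (g : A.EnhR H) :
    (inner ℂ g (A.diagR (fun p => idTensor (A.multiplier Λ p)) g)).re = (Λ (A.gramR g)).re := by
  have h : inner ℂ g (A.diagR (fun p => idTensor (A.multiplier Λ p)) g) =
      star (Λ (A.gramR g)) := by
    rw [← A.sum_inner_coefR, apply_eq_sum_entry]
    simp only [star_sum]
    refine Finset.sum_congr rfl fun p _ => Finset.sum_congr rfl fun i _ => ?_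
    have hs : star (A.multiplier Λ p) = A.multiplier Λ p :=
      (isPositive_multiplier hΛ p).isSelfAdjoint
    rw [coefR, contractR_diagR_idTensor, hs, A.multiplier_basis, contractR_sum, inner_sum]
    refine Finset.sum_congr rfl fun j _ => ?_
    rw [inner_smul_right, star_mul', mul_comm, gramR]
    congr 1
    exact (inner_conj_symm _ _).symm
  rw [h]
  rfl

theorem star_diagS_idTensor (Γ : ∀ p, H p →L[ℂ] H p) :
    star (A.diagS (fun p => idTensor (Γ p))) = A.diagS (fun p => idTensor (star (Γ p))) := by
  refine (star_coordMap _).trans ?_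
  simp only [star_idTensor]
  rfl

theorem star_diagR_idTensor (Γ : ∀ p, H p →L[ℂ] H p) :
    star (A.diagR (fun p => idTensor (Γ p))) = A.diagR (fun p => idTensor (star (Γ p))) := by
  refine (star_coordMap _).trans ?_
  simp only [star_idTensor]
  rfl

theorem isSelfAdjoint_diagS_sub {Γ : ∀ p, H p →L[ℂ] H p} (hΓ : ∀ p, IsSelfAdjoint (Γ p))
    (M : A.EnhS H →L[ℂ] A.EnhR H) :
    IsSelfAdjoint (A.diagS (fun p => idTensor (Γ p)) -
      ContinuousLinearMap.adjoint M ∘L A.diagR (fun p => idTensor (Γ p)) ∘L M) := by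
  have hS : IsSelfAdjoint (A.diagS (fun p => idTensor (Γ p))) := by
    rw [isSelfAdjoint_iff, star_diagS_idTensor]
    simp only [(hΓ _).star_eq]
  have hR : IsSelfAdjoint (A.diagR (fun p => idTensor (Γ p))) := by
    rw [isSelfAdjoint_iff, star_diagR_idTensor]
    simp only [(hΓ _).star_eq]
  exact hS.sub (hR.adjoint_conj M)

theorem inner_diagS_sub (Γ : ∀ p, H p →L[ℂ] H p) (M : A.EnhS H →L[ℂ] A.EnhR H) (f : A.EnhS H) :
    inner ℂ f ((A.diagS (fun p => idTensor (Γ p)) -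
      ContinuousLinearMap.adjoint M ∘L A.diagR (fun p => idTensor (Γ p)) ∘L M) f) =
    inner ℂ f (A.diagS (fun p => idTensor (Γ p)) f) -
      inner ℂ (M f) (A.diagR (fun p => idTensor (Γ p)) (M f)) := by
  rw [sub_apply, inner_sub_right, ContinuousLinearMap.comp_apply, ContinuousLinearMap.comp_apply,
    ContinuousLinearMap.adjoint_inner_right]

/-- Robust invertibility for structured contractions yields the strict linear matrix inequality.
-/
theorem exists_multipliers {M : A.EnhS H →L[ℂ] A.EnhR H} (hM : A.ShiftInvariant M)
    (h1 : ∀ W : ∀ p, A.TildeR p →L[ℂ] A.TildeS p, (∀ p, ‖W p‖ ≤ 1) →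
      IsUnit (1 - A.blockDiag W ∘L M)) :
    ∃ Γ : ∀ p, H p →L[ℂ] H p, (∀ p, IsStrictlyPositive (Γ p)) ∧
      IsStrictlyPositive (A.diagS (fun p => idTensor (Γ p)) -
        ContinuousLinearMap.adjoint M ∘L A.diagR (fun p => idTensor (Γ p)) ∘L M) := by
  by_cases hne : ∃ p, Nontrivial (H p)
  swap
  -- If all spaces `H p` are zero, then so is `H_S`.
  · have hsub : Subsingleton (A.EnhS H) := by
      push Not at hne
      refine ⟨fun x y => ?_⟩
      ext s n
      exact (hne s.1).elim _ _
    refine ⟨fun p => 1, fun p => isStrictlyPositive_one, ?_⟩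
    exact IsStrictlyPositive.of_subsingleton
  obtain ⟨δ, hδ, hgram⟩ := A.exists_pos_forall_gramLE hM h1
  obtain ⟨Λ, hΛ, hdef⟩ := A.exists_separating_functional hM hgram hne
  set τ : ℝ := (Λ (A.oneFam H)).re with hτ
  have hτ0 : 0 < τ := hΛ _ A.oneFam_mem_accretive
  have hgap : ∀ f, δ * τ * ‖f‖ ^ 2 ≤ (Λ (A.gramS f)).re - (Λ (A.gramR (M f))).re := by
    intro f
    have h := hdef f
    rw [defect, tr_gramS, map_add, map_sub, map_smul, smul_eq_mul, ← Complex.ofReal_mul,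
      Complex.add_re, Complex.sub_re, Complex.re_ofReal_mul, ← hτ] at h
    linarith
  -- Adding `κ` to the multipliers makes them strictly positive and costs at most half of the gap.
  set κ : ℝ := δ * τ / (2 * (‖M‖ ^ 2 + 1)) with hκ
  have hκ0 : 0 < κ := by positivity
  have hκM : κ * ‖M‖ ^ 2 ≤ δ * τ / 2 := by
    rw [hκ, div_mul_eq_mul_div, div_le_div_iff₀ (by positivity) (by positivity)]
    nlinarith [mul_pos hδ hτ0]
  have hsa : ∀ p, IsSelfAdjoint (A.multiplier Λ p + (κ : ℂ) • (1 : H p →L[ℂ] H p)) := fun p =>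
    (isPositive_multiplier hΛ p).isSelfAdjoint.add
      ((show IsSelfAdjoint (κ : ℂ) from Complex.conj_ofReal κ).smul (IsSelfAdjoint.one _))
  refine ⟨fun p => A.multiplier Λ p + (κ : ℂ) • (1 : H p →L[ℂ] H p), fun p => ?_, ?_⟩
  · refine isStrictlyPositive_of_le_re_inner (hsa p) hκ0 fun a => ?_
    obtain ⟨r, hr, h⟩ := inner_multiplier_eq_re hΛ p a
    rw [add_apply, inner_add_right, h, smul_apply, one_apply_eq_self, inner_smul_right,
      inner_self_eq_norm_sq_to_K, Complex.add_re, Complex.ofReal_re, Complex.re_ofReal_mul]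
    have : (((‖a‖ : ℝ) : ℂ) ^ 2).re = ‖a‖ ^ 2 := by norm_cast
    simp only [Complex.coe_algebraMap, this]
    linarith
  · refine isStrictlyPositive_of_le_re_inner (isSelfAdjoint_diagS_sub hsa M)
      (c := δ * τ / 2) (by positivity) fun f => ?_
    have hMf : ‖M f‖ ^ 2 ≤ ‖M‖ ^ 2 * ‖f‖ ^ 2 := by
      rw [← mul_pow]
      gcongr
      exact M.le_opNorm f
    have e1 : inner ℂ f f = ((‖f‖ ^ 2 : ℝ) : ℂ) := by
      rw [inner_self_eq_norm_sq_to_K]; push_cast; rfl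
    have e2 : inner ℂ (M f) (M f) = ((‖M f‖ ^ 2 : ℝ) : ℂ) := by
      rw [inner_self_eq_norm_sq_to_K]; push_cast; rfl
    rw [inner_diagS_sub, diagS_idTensor_add_smul, diagR_idTensor_add_smul, add_apply, add_apply,
      inner_add_right, inner_add_right, smul_apply, smul_apply, one_apply_eq_self,
      one_apply_eq_self, inner_smul_right, inner_smul_right, e1, e2, ← Complex.ofReal_mul,
      ← Complex.ofReal_mul, Complex.sub_re, Complex.add_re, Complex.add_re, Complex.ofReal_re,
      Complex.ofReal_re, re_inner_diagS_multiplier hΛ, re_inner_diagR_multiplier hΛ]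
    have h3 := hgap f
    nlinarith [mul_le_mul_of_nonneg_left hMf hκ0.le, mul_le_mul_of_nonneg_right hκM (sq_nonneg ‖f‖),
      mul_nonneg hκ0.le (sq_nonneg ‖f‖)]

end AdmissibleGraph

/-! ### Similarity, coercivity and ampliations -/

theorem isUnit_one_sub_comp_swap {E F : Type*} [NormedAddCommGroup E] [NormedSpace ℂ E]
    [NormedAddCommGroup F] [NormedSpace ℂ F] {S : E →L[ℂ] F} {T : F →L[ℂ] E}
    (h : IsUnit (1 - S ∘L T)) : IsUnit (1 - T ∘L S) := by
  obtain ⟨u, hu⟩ := h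
  have h1 : ∀ x, (↑u⁻¹ : F →L[ℂ] F) x - S (T ((↑u⁻¹ : F →L[ℂ] F) x)) = x := fun x => by
    have := DFunLike.congr_fun u.mul_inv x
    rw [hu] at this
    simpa using this
  have h2 : ∀ x, (↑u⁻¹ : F →L[ℂ] F) x - (↑u⁻¹ : F →L[ℂ] F) (S (T x)) = x := fun x => by
    have := DFunLike.congr_fun u.inv_mul x
    rw [hu] at this
    simpa using this
  refine ⟨⟨1 - T ∘L S, 1 + T ∘L (↑u⁻¹ : F →L[ℂ] F) ∘L S, ?_, ?_⟩, rfl⟩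
  · ext x
    have := congrArg T (h1 (S x))
    simp only [map_sub] at this
    simp only [mul_apply_eq_comp, sub_apply, add_apply, one_apply_eq_self,
      ContinuousLinearMap.comp_apply, map_add]
    rw [← this]
    abel
  · ext x
    have := congrArg T (h2 (S x))
    simp only [map_sub] at this
    simp only [mul_apply_eq_comp, sub_apply, add_apply, one_apply_eq_self,
      ContinuousLinearMap.comp_apply, map_sub]
    rw [sub_eq_iff_eq_add.mp this]
    abel

theorem exists_le_re_inner_of_isStrictlyPositive {K : Type*} [NormedAddCommGroup K]
    [InnerProductSpace ℂ K] [CompleteSpace K] {T : K →L[ℂ] K} (hT : IsStrictlyPositive T) :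
    ∃ c : ℝ, 0 < c ∧ ∀ x, c * ‖x‖ ^ 2 ≤ (inner ℂ x (T x)).re := by
  obtain ⟨b, ⟨u, rfl⟩, rfl⟩ := CStarAlgebra.isStrictlyPositive_iff_eq_star_mul_self.mp hT
  set D := ‖(↑u⁻¹ : K →L[ℂ] K)‖ with hD
  refine ⟨(D ^ 2 + 1)⁻¹, by positivity, fun x => ?_⟩
  have h1 : (inner ℂ x ((star (u : K →L[ℂ] K) * u) x)).re = ‖(u : K →L[ℂ] K) x‖ ^ 2 := by
    rw [mul_apply_eq_comp, ← inner_star_left, star_star, inner_self_eq_norm_sq_to_K]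
    norm_cast
  have h2 : ‖x‖ ≤ D * ‖(u : K →L[ℂ] K) x‖ := by
    have h3 : (↑u⁻¹ : K →L[ℂ] K) ((u : K →L[ℂ] K) x) = x := by
      rw [← mul_apply_eq_comp, Units.inv_mul, one_apply_eq_self]
    conv_lhs => rw [← h3]
    exact ContinuousLinearMap.le_opNorm _ _
  rw [h1, inv_mul_le_iff₀ (by positivity)]
  have h4 : ‖x‖ ^ 2 ≤ (D * ‖(u : K →L[ℂ] K) x‖) ^ 2 := by gcongr
  nlinarith [sq_nonneg ‖(u : K →L[ℂ] K) x‖]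

theorem sum_inner_smul_idTensor {K : Type*} [NormedAddCommGroup K] [InnerProductSpace ℂ K]
    [FiniteDimensional ℂ K] (b : K) (g : Ell2 K) :
    ∑ i, inner ℂ b (stdOrthonormalBasis ℂ K i) •
      idTensor (innerSL ℂ (stdOrthonormalBasis ℂ K i)) g = idTensor (innerSL ℂ b) g := by
  ext n
  simp only [lp.coeFn_sum, lp.coeFn_smul, Finset.sum_apply, Pi.smul_apply, idTensor_apply,
    innerSL_apply_apply, smul_eq_mul]
  exact (stdOrthonormalBasis ℂ K).sum_inner_mul_inner b (g n)

theorem enorm_smul_clm {E F : Type*} [NormedAddCommGroup E] [NormedSpace ℂ E]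
    [NormedAddCommGroup F] [NormedSpace ℂ F] (t : ℂ) (T : E →L[ℂ] F) :
    ‖t • T‖ₑ = ‖t‖ₑ * ‖T‖ₑ := by
  rw [← ofReal_norm, norm_smul, ENNReal.ofReal_mul (norm_nonneg _), ofReal_norm, ofReal_norm]

/-- If `T` intertwines `X` and `Y`, then `M T` is similar to `(X M Y⁻¹) T`. -/
theorem one_le_enorm_mul_enorm {E F : Type*} [NormedAddCommGroup E] [NormedSpace ℂ E]
    [NormedAddCommGroup F] [NormedSpace ℂ F] [CompleteSpace F] {X : (F →L[ℂ] F)ˣ}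
    {Y : (E →L[ℂ] E)ˣ} {M : E →L[ℂ] F} {T : F →L[ℂ] E}
    (hTX : T ∘L (X : F →L[ℂ] F) = (Y : E →L[ℂ] E) ∘L T)
    (hspec : (1 : ℂ) ∈ spectrum ℂ (M ∘L T)) :
    1 ≤ ‖(X : F →L[ℂ] F) ∘L M ∘L (↑Y⁻¹ : E →L[ℂ] E)‖ₑ * ‖T‖ₑ := by
  have h1 : T ∘L (↑X⁻¹ : F →L[ℂ] F) = (↑Y⁻¹ : E →L[ℂ] E) ∘L T := by
    ext1 x
    have e1 : (X : F →L[ℂ] F) ((↑X⁻¹ : F →L[ℂ] F) x) = x := DFunLike.congr_fun X.mul_inv x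
    have e2 : ∀ y, (↑Y⁻¹ : E →L[ℂ] E) ((Y : E →L[ℂ] E) y) = y :=
      fun y => DFunLike.congr_fun Y.inv_mul y
    have e3 := DFunLike.congr_fun hTX ((↑X⁻¹ : F →L[ℂ] F) x)
    simp only [ContinuousLinearMap.comp_apply, e1] at e3 ⊢
    rw [e3, e2]
  have h2 : (X : F →L[ℂ] F) * (M ∘L T) * (↑X⁻¹ : F →L[ℂ] F) =
      ((X : F →L[ℂ] F) ∘L M ∘L (↑Y⁻¹ : E →L[ℂ] E)) ∘L T := by
    change (X : F →L[ℂ] F) ∘L M ∘L (T ∘L (↑X⁻¹ : F →L[ℂ] F)) = _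
    rw [h1]
    rfl
  rw [← spectrum.units_conjugate (u := X), h2] at hspec
  have h3 := spectrum.norm_le_norm_mul_of_mem hspec
  rw [norm_one] at h3
  rw [← ofReal_norm, ← ofReal_norm, ← ENNReal.ofReal_mul (norm_nonneg _), ENNReal.one_le_ofReal]
  refine h3.trans ?_
  refine (mul_le_of_le_one_right (norm_nonneg _) ContinuousLinearMap.norm_id_le).trans ?_
  exact ContinuousLinearMap.opNorm_comp_le _ _

/-- A strict bound `‖X M y‖² ≤ ‖Y y‖² - c ‖y‖²` means that `X M Y⁻¹` is a strict contraction. -/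
theorem norm_comp_inv_lt_one {E F : Type*} [NormedAddCommGroup E] [NormedSpace ℂ E]
    [NormedAddCommGroup F] [NormedSpace ℂ F] {X : F →L[ℂ] F} {Y : (E →L[ℂ] E)ˣ} {M : E →L[ℂ] F}
    {c : ℝ} (hc : 0 < c)
    (h : ∀ y, c * ‖y‖ ^ 2 ≤ ‖(Y : E →L[ℂ] E) y‖ ^ 2 - ‖X (M y)‖ ^ 2) :
    ‖X ∘L M ∘L (↑Y⁻¹ : E →L[ℂ] E)‖ < 1 := by
  set d : ℝ := c / (‖(Y : E →L[ℂ] E)‖ ^ 2 + 1) with hd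
  have hd0 : 0 < d := by positivity
  have hlt : √(1 - d) < 1 := by
    rw [Real.sqrt_lt' one_pos]
    linarith
  refine lt_of_le_of_lt ?_ hlt
  refine ContinuousLinearMap.opNorm_le_bound _ (Real.sqrt_nonneg _) fun z => ?_
  set y := (↑Y⁻¹ : E →L[ℂ] E) z with hy
  have hYy : (Y : E →L[ℂ] E) y = z := DFunLike.congr_fun Y.mul_inv z
  have h1 := h y
  rw [hYy] at h1
  have h2 : ‖z‖ ^ 2 ≤ (‖(Y : E →L[ℂ] E)‖ ^ 2 + 1) * ‖y‖ ^ 2 := by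
    have : ‖z‖ ^ 2 ≤ (‖(Y : E →L[ℂ] E)‖ * ‖y‖) ^ 2 := by
      rw [← hYy]
      gcongr
      exact ContinuousLinearMap.le_opNorm _ _
    nlinarith [sq_nonneg ‖y‖]
  have h3 : d * ‖z‖ ^ 2 ≤ c * ‖y‖ ^ 2 := by
    rw [hd, div_mul_eq_mul_div, div_le_iff₀ (by positivity)]
    nlinarith [mul_le_mul_of_nonneg_left h2 hc.le]
  -- For `d > 1` the square root is zero and the inequality still holds.
  have h4 : 1 - d ≤ √(1 - d) ^ 2 := by
    rw [Real.sq_sqrt']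
    exact le_max_left _ _
  refine abs_le_of_sq_le_sq' (?_ : ‖X (M y)‖ ^ 2 ≤ _) (by positivity) |>.2
  rw [mul_pow]
  nlinarith [mul_le_mul_of_nonneg_right h4 (sq_nonneg ‖z‖)]

theorem tensorId_idTensor {K : Type*} [NormedAddCommGroup K] [InnerProductSpace ℂ K]
    [FiniteDimensional ℂ K] (Z : Ell2 ℂ →L[ℂ] Ell2 ℂ) (B : K →L[ℂ] K) (f : Ell2 K) :
    tensorId Z (idTensor B f) = idTensor B (tensorId Z f) := by
  -- Both sides agree after contraction against every `b`, where `Z ⊗ I` turns into `Z`.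
  have key : ∀ (b : K) (g : Ell2 K),
      idTensor (innerSL ℂ b) (tensorId Z g) = Z (idTensor (innerSL ℂ b) g) := by
    intro b g
    simp only [tensorId, sum_apply, ContinuousLinearMap.comp_apply, map_sum,
      idTensor_inner_tensorVec]
    rw [← sum_inner_smul_idTensor b g, map_sum]
    simp only [map_smul]
  refine ell2_ext_of_innerSL fun b => ?_
  rw [key, idTensor_innerSL_idTensor, idTensor_innerSL_idTensor, key]

namespace AdmissibleGraph

theorem enhanced_smul_mem {V : Type*} {A : AdmissibleGraph V} {H : A.Comp → Type*}
    [∀ p, NormedAddCommGroup (H p)] [∀ p, InnerProductSpace ℂ (H p)]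
    [∀ p, FiniteDimensional ℂ (H p)] (t : ℂ) (p : A.Comp) (Z : Ell2 (H p) →L[ℂ] Ell2 (H p))
    (hZ : Z ∈ A.enhanced H p) : t • Z ∈ A.enhanced H p := by
  obtain ⟨Z', rfl⟩ := hZ
  refine ⟨t • Z', ?_⟩
  simp only [tensorId, Finset.smul_sum, ContinuousLinearMap.smul_comp,
    ContinuousLinearMap.comp_smul]

section General

/-! ### Scaling and the easy inequality -/

variable {V : Type*} [Finite V] {A : AdmissibleGraph V} {H : A.Comp → Type*}
  [∀ p, NormedAddCommGroup (H p)] [∀ p, InnerProductSpace ℂ (H p)]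

theorem mu_le_muHat [∀ p, CompleteSpace (H p)] (D : ∀ p, Set (H p →L[ℂ] H p))
    (M : A.HS H →L[ℂ] A.HR H) : A.mu D M ≤ A.muHat D M := by
  refine le_iInf fun X => le_iInf fun Y => le_iInf fun hXY => ?_
  rw [mu, ENNReal.inv_le_iff_inv_le]
  refine le_iInf fun T => le_iInf fun hT => ?_
  have h := one_le_enorm_mul_enorm (hXY T hT.1) hT.2
  refine (ENNReal.inv_le_iff_le_mul (fun _ h0 => ?_) fun h0 => absurd h0 enorm_ne_top).mpr h
  rw [h0, zero_mul] at h
  exact absurd h (by simp)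

theorem uncertainty_smul_mem {D : ∀ p, Set (H p →L[ℂ] H p)} {t : ℂ}
    (hD : ∀ p, ∀ Z ∈ D p, t • Z ∈ D p) {T : A.HR H →L[ℂ] A.HS H} (hT : T ∈ A.uncertainty D) :
    t • T ∈ A.uncertainty D := by
  obtain ⟨Z, hZ, rfl⟩ := hT
  refine ⟨fun e => t • Z e, fun e => hD _ _ (hZ e), ?_⟩
  simp only [pencil, Finset.smul_sum, ContinuousLinearMap.smul_comp, ContinuousLinearMap.comp_smul]

theorem mu_smul_le {D : ∀ p, Set (H p →L[ℂ] H p)} {t : ℂ} (ht : t ≠ 0)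
    (hD : ∀ p, ∀ Z ∈ D p, t • Z ∈ D p) (M : A.HS H →L[ℂ] A.HR H) :
    A.mu D (t • M) ≤ ‖t‖ₑ * A.mu D M := by
  have ht0 : ‖t‖ₑ ≠ 0 := by simpa using ht
  have ht1 : ‖t‖ₑ ≠ ⊤ := by simp
  rw [mu, ENNReal.inv_le_iff_inv_le]
  refine le_iInf fun T => le_iInf fun hT => ?_
  have hT' : t • T ∈ {T ∈ A.uncertainty D | (1 : ℂ) ∈ spectrum ℂ (M ∘L T)} := by
    refine ⟨uncertainty_smul_mem hD hT.1, ?_⟩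
    have h := hT.2
    rwa [ContinuousLinearMap.smul_comp, ← ContinuousLinearMap.comp_smul] at h
  have h1 := iInf₂_le (f := fun T (_ : T ∈ {T ∈ A.uncertainty D |
    (1 : ℂ) ∈ spectrum ℂ (M ∘L T)}) => ‖T‖ₑ) (t • T) hT'
  rw [mu, ENNReal.mul_inv (Or.inl ht0) (Or.inl ht1), inv_inv, ← ENNReal.div_eq_inv_mul]
  refine ENNReal.div_le_of_le_mul ?_
  rwa [enorm_smul_clm, mul_comm] at h1

end General

variable {V : Type*} [Finite V] {A : AdmissibleGraph V} {H : A.Comp → Type*}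
  [∀ p, NormedAddCommGroup (H p)] [∀ p, InnerProductSpace ℂ (H p)]

theorem ShiftInvariant.smul {M : A.EnhS H →L[ℂ] A.EnhR H} (hM : A.ShiftInvariant M) (t : ℂ) :
    A.ShiftInvariant (t • M) := by
  unfold ShiftInvariant at hM ⊢
  rw [ContinuousLinearMap.comp_smul, hM, ContinuousLinearMap.smul_comp]

/-! ### The structured scalings and perturbations -/

theorem diagS_idTensor_mul (B C : ∀ p, H p →L[ℂ] H p) :
    A.diagS (fun p => idTensor (B p)) * A.diagS (fun p => idTensor (C p)) =
      A.diagS fun p => idTensor (B p * C p) := coordMap_mul _ _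

theorem diagR_idTensor_mul (B C : ∀ p, H p →L[ℂ] H p) :
    A.diagR (fun p => idTensor (B p)) * A.diagR (fun p => idTensor (C p)) =
      A.diagR fun p => idTensor (B p * C p) := coordMap_mul _ _

theorem diagS_idTensor_one : A.diagS (fun p => idTensor (1 : H p →L[ℂ] H p)) = 1 := coordMap_one

theorem diagR_idTensor_one : A.diagR (fun p => idTensor (1 : H p →L[ℂ] H p)) = 1 := coordMap_one

/-- The direct sum over the source vertices of the operators `I ⊗ u [s]`, as a unit. -/
def unitS (u : ∀ p, (H p →L[ℂ] H p)ˣ) : (A.EnhS H →L[ℂ] A.EnhS H)ˣ where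
  val := A.diagS fun p => idTensor (u p : H p →L[ℂ] H p)
  inv := A.diagS fun p => idTensor (↑(u p)⁻¹ : H p →L[ℂ] H p)
  val_inv := by simp only [diagS_idTensor_mul, Units.mul_inv, diagS_idTensor_one]
  inv_val := by simp only [diagS_idTensor_mul, Units.inv_mul, diagS_idTensor_one]

/-- The direct sum over the range vertices of the operators `I ⊗ u [r]`, as a unit. -/
def unitR (u : ∀ p, (H p →L[ℂ] H p)ˣ) : (A.EnhR H →L[ℂ] A.EnhR H)ˣ where
  val := A.diagR fun p => idTensor (u p : H p →L[ℂ] H p)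
  inv := A.diagR fun p => idTensor (↑(u p)⁻¹ : H p →L[ℂ] H p)
  val_inv := by simp only [diagR_idTensor_mul, Units.mul_inv, diagR_idTensor_one]
  inv_val := by simp only [diagR_idTensor_mul, Units.inv_mul, diagR_idTensor_one]

variable [∀ p, FiniteDimensional ℂ (H p)]

theorem mem_intertwining_enhanced (B : ∀ p, H p →L[ℂ] H p) :
    (A.diagR (fun p => idTensor (B p)), A.diagS (fun p => idTensor (B p))) ∈
      A.intertwining (A.enhanced H) := by
  rintro _ ⟨Z, hZ, rfl⟩
  ext1 x
  simp only [pencil, ContinuousLinearMap.comp_apply, sum_apply, map_sum]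
  refine Finset.sum_congr rfl fun e _ => ?_
  obtain ⟨Z', hZ'⟩ := hZ e
  have h1 : A.projR (fun p => Ell2 (H p)) e.rng (A.diagR (fun p => idTensor (B p)) x) =
      idTensor (B e.comp) (A.projR (fun p => Ell2 (H p)) e.rng x) :=
    coordMap_apply (fun r : A.Rng => idTensor (B r.1)) x ⟨e.comp, e.rng⟩
  have h2 : ∀ y, A.diagS (fun p => idTensor (B p)) (A.embS (fun p => Ell2 (H p)) e.src y) =
      A.embS (fun p => Ell2 (H p)) e.src (idTensor (B e.comp) y) := fun y =>
    coordMap_sumEmb (fun s : A.Src => idTensor (B s.1)) ⟨e.comp, e.src⟩ y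
  rw [h1, h2, ← hZ', tensorId_idTensor]

/-- The operators `diag_p (W_p ⊗ I)` belong to the uncertainty set, since all pairs of a source
and a range vertex of one component are edges. -/
theorem blockDiag_mem_uncertainty (W : ∀ p, A.TildeR p →L[ℂ] A.TildeS p) :
    A.blockDiag W ∈ A.uncertainty (A.enhanced H) := by
  refine ⟨fun e => tensorId (sumProj (fun _ : A.SrcOf e.comp => Ell2 ℂ) e.src ∘L W e.comp ∘L
    sumEmb (fun _ : A.RngOf e.comp => Ell2 ℂ) e.rng), fun e => Set.mem_range_self _, ?_⟩
  have hadj : ∀ k : Σ p : A.Comp, A.SrcOf p × A.RngOf p, A.G.Adj k.2.1.1 k.2.2.1 := by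
    rintro ⟨p, ⟨s, hs, hsp⟩, ⟨r, hr, hrp⟩⟩
    exact A.complete s hs r hr (SimpleGraph.ConnectedComponent.exact (hsp.trans hrp.symm))
  let E : A.Edge ≃ Σ p : A.Comp, A.SrcOf p × A.RngOf p := Equiv.subtypeUnivEquiv hadj
  have hsum : ∀ F : (Σ p : A.Comp, A.SrcOf p × A.RngOf p) → (A.EnhR H →L[ℂ] A.EnhS H),
      ∑ e : A.Edge, F (E e) = ∑ p, ∑ s, ∑ r, F ⟨p, s, r⟩ := fun F => by
    rw [E.sum_comp, Fintype.sum_sigma]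
    exact Finset.sum_congr rfl fun p _ => Fintype.sum_prod_type _
  refine Eq.trans ?_ (hsum fun k => A.embS (fun p => Ell2 (H p)) k.2.1 ∘L
    tensorId (sumProj (fun _ : A.SrcOf k.1 => Ell2 ℂ) k.2.1 ∘L W k.1 ∘L
      sumEmb (fun _ : A.RngOf k.1 => Ell2 ℂ) k.2.2) ∘L
    A.projR (fun p => Ell2 (H p)) k.2.2).symm
  rw [blockDiag]
  refine Finset.sum_congr rfl fun p _ => ?_
  ext1 x
  simp only [tensorId, tensorVecS, contractR, sum_apply, ContinuousLinearMap.comp_apply, map_sum]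
  exact Finset.sum_comm.trans
    ((Finset.sum_congr rfl fun r _ => Finset.sum_comm).trans Finset.sum_comm)

theorem units_mem_intertwining (u : ∀ p, (H p →L[ℂ] H p)ˣ) :
    ((unitR u : A.EnhR H →L[ℂ] A.EnhR H), (unitS u : A.EnhS H →L[ℂ] A.EnhS H)) ∈
      A.intertwining (A.enhanced H) :=
  mem_intertwining_enhanced fun p => (u p : H p →L[ℂ] H p)

theorem muHat_lt_one_of_multipliers {M : A.EnhS H →L[ℂ] A.EnhR H} {Γ : ∀ p, H p →L[ℂ] H p}
    (hΓ : ∀ p, IsStrictlyPositive (Γ p))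
    (hT : IsStrictlyPositive (A.diagS (fun p => idTensor (Γ p)) -
      ContinuousLinearMap.adjoint M ∘L A.diagR (fun p => idTensor (Γ p)) ∘L M)) :
    A.muHat (A.enhanced H) M < 1 := by
  have hroot : ∀ p, ∃ u : (H p →L[ℂ] H p)ˣ, Γ p = star (u : H p →L[ℂ] H p) * u := fun p => by
    obtain ⟨b, ⟨u, rfl⟩, h⟩ := CStarAlgebra.isStrictlyPositive_iff_eq_star_mul_self.mp (hΓ p)
    exact ⟨u, h⟩
  choose u hu using hroot
  set X : (A.EnhR H →L[ℂ] A.EnhR H)ˣ := unitR u with hX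
  set Y : (A.EnhS H →L[ℂ] A.EnhS H)ˣ := unitS u with hY
  have hS : ∀ y, (inner ℂ y (A.diagS (fun p => idTensor (Γ p)) y)).re =
      ‖(Y : A.EnhS H →L[ℂ] A.EnhS H) y‖ ^ 2 := fun y => by
    have e : A.diagS (fun p => idTensor (Γ p)) =
        star (Y : A.EnhS H →L[ℂ] A.EnhS H) * (Y : A.EnhS H →L[ℂ] A.EnhS H) := by
      simp only [hY, unitS, star_diagS_idTensor, diagS_idTensor_mul, hu]
    rw [e, mul_apply_eq_comp, ← inner_star_left, star_star, inner_self_eq_norm_sq_to_K]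
    norm_cast
  have hR : ∀ y, (inner ℂ y (A.diagR (fun p => idTensor (Γ p)) y)).re =
      ‖(X : A.EnhR H →L[ℂ] A.EnhR H) y‖ ^ 2 := fun y => by
    have e : A.diagR (fun p => idTensor (Γ p)) =
        star (X : A.EnhR H →L[ℂ] A.EnhR H) * (X : A.EnhR H →L[ℂ] A.EnhR H) := by
      simp only [hX, unitR, star_diagR_idTensor, diagR_idTensor_mul, hu]
    rw [e, mul_apply_eq_comp, ← inner_star_left, star_star, inner_self_eq_norm_sq_to_K]
    norm_cast
  obtain ⟨c, hc, hcoer⟩ := exists_le_re_inner_of_isStrictlyPositive hT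
  have hnorm : ‖(X : A.EnhR H →L[ℂ] A.EnhR H) ∘L M ∘L (↑Y⁻¹ : A.EnhS H →L[ℂ] A.EnhS H)‖ < 1 :=
    norm_comp_inv_lt_one hc fun y => by
      have h1 := hcoer y
      have h2 := congrArg Complex.re (inner_diagS_sub Γ M y)
      rw [Complex.sub_re, hS, hR] at h2
      exact h1.trans h2.le
  have hle : A.muHat (A.enhanced H) M ≤
      ‖(X : A.EnhR H →L[ℂ] A.EnhR H) ∘L M ∘L (↑Y⁻¹ : A.EnhS H →L[ℂ] A.EnhS H)‖ₑ :=
    iInf_le_of_le X (iInf_le_of_le Y (iInf_le_of_le (units_mem_intertwining u) le_rfl))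
  refine hle.trans_lt ?_
  rwa [← ofReal_norm, ENNReal.ofReal_lt_one]

theorem exists_isUnit_of_mu_lt_one {M : A.EnhS H →L[ℂ] A.EnhR H}
    (h : A.mu (A.enhanced H) M < 1) :
    ∃ ρ : ℝ, 1 < ρ ∧ ∀ W : ∀ p, A.TildeR p →L[ℂ] A.TildeS p, (∀ p, ‖W p‖ ≤ ρ) →
      IsUnit (1 - A.blockDiag W ∘L M) := by
  rw [mu, ENNReal.inv_lt_one] at h
  obtain ⟨r, hr1, hr2⟩ := ENNReal.lt_iff_exists_nnreal_btwn.mp h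
  refine ⟨r, by exact_mod_cast hr1, fun W hW => ?_⟩
  have hn := A.norm_blockDiag_le (H := H) r.2 hW
  have hspec : (1 : ℂ) ∉ spectrum ℂ (M ∘L A.blockDiag W) := by
    intro hs
    have h1 := iInf₂_le (f := fun T (_ : T ∈ {T ∈ A.uncertainty (A.enhanced H) |
      (1 : ℂ) ∈ spectrum ℂ (M ∘L T)}) => ‖T‖ₑ) _ ⟨blockDiag_mem_uncertainty W, hs⟩
    have h2 := hr2.trans_le h1
    rw [← ofReal_norm] at h2
    exact absurd h2 (not_lt.mpr (ENNReal.ofReal_le_coe.mpr hn))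
  rw [spectrum.notMem_iff, map_one] at hspec
  exact isUnit_one_sub_comp_swap hspec

/-- If `μ < 1` implies `μ̂ < 1` for all multiples of `M`, then `μ̂ ≤ μ`, by homogeneity. -/
theorem muHat_le_mu {M : A.EnhS H →L[ℂ] A.EnhR H}
    (h : ∀ t : ℂ, A.mu (A.enhanced H) (t • M) < 1 → A.muHat (A.enhanced H) (t • M) < 1) :
    A.muHat (A.enhanced H) M ≤ A.mu (A.enhanced H) M := by
  refine le_of_forall_gt fun a ha => ?_
  obtain ⟨r, hr1, hr2⟩ := ENNReal.lt_iff_exists_nnreal_btwn.mp ha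
  have hr0 : r ≠ 0 := by
    rintro rfl
    simp at hr1
  set t : ℂ := ((r⁻¹ : ℝ) : ℂ) with ht
  have ht0 : t ≠ 0 := by simpa [ht] using hr0
  have htn : ‖t‖ₑ = (r : ℝ≥0∞)⁻¹ := by
    rw [← ENNReal.coe_inv hr0, enorm_eq_nnnorm]
    congr 1
    ext
    simp [ht]
  have h1 : A.mu (A.enhanced H) (t • M) < 1 := by
    refine (mu_smul_le ht0 (fun p Z hZ => enhanced_smul_mem t p Z hZ) M).trans_lt ?_
    rw [htn, ← ENNReal.div_eq_inv_mul]
    exact ENNReal.div_lt_of_lt_mul (by rwa [one_mul])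
  have h2 := h t h1
  rw [muHat] at h2
  simp only [iInf_lt_iff] at h2
  obtain ⟨X, Y, hXY, h3⟩ := h2
  refine lt_of_le_of_lt (iInf_le_of_le X (iInf_le_of_le Y (iInf_le _ hXY))) (lt_of_le_of_lt ?_ hr2)
  rw [ContinuousLinearMap.smul_comp, ContinuousLinearMap.comp_smul, enorm_smul_clm, htn,
    ← ENNReal.div_eq_inv_mul] at h3
  have h4 := (ENNReal.div_lt_iff (Or.inl (by simpa using hr0)) (Or.inl ENNReal.coe_ne_top)).mp h3
  rw [one_mul] at h4
  exact h4.le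

end AdmissibleGraph

end

theorem theorem5p1 {V : Type*} [Finite V] (A : AdmissibleGraph V)
    (H : A.Comp → Type*) [∀ p, NormedAddCommGroup (H p)] [∀ p, InnerProductSpace ℂ (H p)]
    [∀ p, FiniteDimensional ℂ (H p)]
    (M : A.EnhS H →L[ℂ] A.EnhR H) (hM : A.ShiftInvariant M) :
    A.mu (A.enhanced H) M = A.muHat (A.enhanced H) M ∧
    [ A.mu (A.enhanced H) M < 1,
      ∃ ρ : ℝ, 1 < ρ ∧ ∀ W : ∀ p, A.TildeR p →L[ℂ] A.TildeS p, (∀ p, ‖W p‖ ≤ ρ) →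
        IsUnit (1 - A.blockDiag W ∘L M),
      A.muHat (A.enhanced H) M < 1,
      ∃ Γ : ∀ p, H p →L[ℂ] H p, (∀ p, IsStrictlyPositive (Γ p)) ∧
        IsStrictlyPositive (A.diagS (fun p => idTensor (Γ p)) -
          ContinuousLinearMap.adjoint M ∘L A.diagR (fun p => idTensor (Γ p)) ∘L M) ].TFAE := by
  have h24 : ∀ {M' : A.EnhS H →L[ℂ] A.EnhR H}, A.ShiftInvariant M' →
      (∃ ρ : ℝ, 1 < ρ ∧ ∀ W : ∀ p, A.TildeR p →L[ℂ] A.TildeS p, (∀ p, ‖W p‖ ≤ ρ) →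
        IsUnit (1 - A.blockDiag W ∘L M')) →
      ∃ Γ : ∀ p, H p →L[ℂ] H p, (∀ p, IsStrictlyPositive (Γ p)) ∧
        IsStrictlyPositive (A.diagS (fun p => idTensor (Γ p)) -
          ContinuousLinearMap.adjoint M' ∘L A.diagR (fun p => idTensor (Γ p)) ∘L M') :=
    fun hM' ⟨_, hρ, h⟩ => AdmissibleGraph.exists_multipliers hM' fun W hW =>
      h W fun p => (hW p).trans hρ.le
  refine ⟨le_antisymm (AdmissibleGraph.mu_le_muHat _ M)
    (AdmissibleGraph.muHat_le_mu fun t ht => ?_), ?_⟩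
  · obtain ⟨Γ, hΓ, hT⟩ := h24 (hM.smul t) (AdmissibleGraph.exists_isUnit_of_mu_lt_one ht)
    exact AdmissibleGraph.muHat_lt_one_of_multipliers hΓ hT
  · tfae_have 1 → 2 := AdmissibleGraph.exists_isUnit_of_mu_lt_one
    tfae_have 2 → 4 := h24 hM
    tfae_have 4 → 3 := fun ⟨_, hΓ, hT⟩ => AdmissibleGraph.muHat_lt_one_of_multipliers hΓ hT
    tfae_have 3 → 1 := fun h => (AdmissibleGraph.mu_le_muHat _ M).trans_lt h
    tfae_finish
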